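/- Let $m,d\ge 1$ be integers, let $I\subset\mathbb{R}^m$ be a compact set of positive Lebesgue measure, and let $V=\{v(x),\,x\in\mathbb{R}^m\}$ be an $\mathbb{R}^d$-valued centered Gaussian process with continuous sample paths, whose component processes $\{v_i(x),\,x\in\mathbb{R}^m\}$, $i=1,\dots,d$, are independent and identically distributed, and such that $$\inf_{x\in I^{(1)}}\operatorname{Var}(v_1(x))>0,$$ where $I^{(1)}=\{x\in\mathbb{R}^m:\operatorname{dist}(x,I)<1\}$. Fix $\delta\in\,]0,1]$ and, for $\varepsilon>0$ and $j=(j_1,\dots,j_m)\in\mathbb{Z}^m$, set $$R_j^\varepsilon=\prod_{l=1}^m\bigl[j_l\,\varepsilon^{1/\delta},(j_l+1)\,\varepsilon^{1/\delta}\bigr].$$ Suppose that there is a constant $c$ such that, for all sufficiently small $\varepsilon>0$ and all $j$ with $R_j^\varepsilon\cap I\neq\varnothing$, $$E\left(\int_{R_j^\varepsilon}dy\int_{R_j^\varepsilon}d\bar y\,\exp\left\{\frac{\|v(y)-v(\bar y)\|}{\|y-\bar y\|^\delta}\right\}\right)\le c\,\varepsilon^{2m/\delta}.$$ Then there is a constant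 $C>0$, depending on neither $\varepsilon$, $j$, $z$ nor $A$, such that for every $\varepsilon\in\,]0,1[$, every $j\in\mathbb{Z}^m$ with $R_j^\varepsilon\cap I\ne\varnothing$ and every $z\in\mathbb{R}^d$, $$P\{v(R_j^\varepsilon)\cap B_\varepsilon(z)\neq\varnothing\}\le C\,\varepsilon^d,$$ and, for every Borel set $A\subset\mathbb{R}^d$, $$P\{v(I)\cap A\neq\varnothing\}\le C\,\mathcal{H}_{d-m/\delta}(A).$$ Here $\|\cdot\|$ is the Euclidean norm, $B_r(x)$ is the open Euclidean ball with center $x$ and radius $r$, and $\mathcal{H}_\gamma(A)=\infty$ if $\gamma<0$, while for $\gamma\ge0$ $$\mathcal{H}_\gamma(A)=\liminf_{\varepsilon\to0^+}\ \inf\Bigl\{\sum_{i}(2r_i)^\gamma:\ A\subset\bigcup_{i}B_{r_i}(x_i),\ \sup_i r_i\le\varepsilon\Bigr\},$$ the infimum being over finite or countably infinite families of balls. -/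

import Mathlib

open MeasureTheory ProbabilityTheory Set Filter Topology
open scoped ENNReal

/-- The closed box `∏ l, [j l * ε ^ (1/δ), (j l + 1) * ε ^ (1/δ)]` in `ℝ^m`. -/
def dyadicBox {m : ℕ} (δ ε : ℝ) (j : Fin m → ℤ) : Set (EuclideanSpace ℝ (Fin m)) :=
  {x | ∀ l, x l ∈ Icc ((j l : ℝ) * ε ^ (1 / δ)) (((j l : ℝ) + 1) * ε ^ (1 / δ))}

/-- The sums `∑ (2 r i) ^ γ` over all coverings of `A` by countably many open balls of radius at
most `ε`. A ball of radius `0` is empty and contributes nothing to the sum, so that finite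
coverings are included. -/
def ballCoverSums {d : ℕ} (γ ε : ℝ) (A : Set (EuclideanSpace ℝ (Fin d))) : Set ℝ≥0∞ :=
  {S | ∃ (x : ℕ → EuclideanSpace ℝ (Fin d)) (r : ℕ → ℝ),
    (∀ i, 0 ≤ r i ∧ r i ≤ ε) ∧ A ⊆ ⋃ i, Metric.ball (x i) (r i) ∧
    S = ∑' i, if 0 < r i then ENNReal.ofReal ((2 * r i) ^ γ) else 0}

open Classical in
/-- The `γ`-dimensional Hausdorff measure, defined by coverings with open balls. It is `∞` on every
set if `γ < 0`. -/
noncomputable def ballHausdorff {d : ℕ} (γ : ℝ) (A : Set (EuclideanSpace ℝ (Fin d))) : ℝ≥0∞ :=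
  if γ < 0 then ∞ else liminf (fun ε : ℝ => sInf (ballCoverSums γ ε A)) (𝓝[>] 0)

/-- The event `{v(S) ∩ A ≠ ∅}`. -/
def hitEvent {Ω : Type*} {m d : ℕ}
    (v : EuclideanSpace ℝ (Fin m) → Ω → EuclideanSpace ℝ (Fin d))
    (S : Set (EuclideanSpace ℝ (Fin m))) (A : Set (EuclideanSpace ℝ (Fin d))) : Set Ω :=
  {ω | ((fun x => v x ω) '' S ∩ A).Nonempty}

/-!
Fix a box `R` of side `ε ^ (1 / δ)` and a point `x₀ ∈ R ∩ I`. The proof compares `v` on `R` with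
the single Gaussian vector `v x₀`.

*Oscillation.* A chaining argument of Garsia-Rodemich-Rumsey type bounds the oscillation of a
continuous function on a convex set by the logarithm of the exponential double integral: for `x ∈
R` the homothetic copies of `R` with centre `x` and ratio `2 ^ (-n)` shrink to `x`, and
consecutive averages differ by at most a constant times `2 ^ (-nδ) (n + 1) ε (1 + log B)`, where
`B` is the normalised double integral. As `(1 + log B) ^ p ≤ p ^ p * B`, the hypothesis on the
expectation gives moments of every order of the oscillation, of size `ε ^ p`
(`enorm_sub_pow_le_lintegral_exp`).

*Decoupling.* The oscillation and `v x₀` are dependent, so `v x` is replaced by its residual `v x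
- c x • v x₀` after regression on `v x₀`. The residual process is independent of `v x₀`
(`indepFun_sub_regression`), and `|c x - 1| = O(ε)` by the second moment of the oscillation
(`abs_regressionCoeff_sub_one_le`). If `v` hits the ball of radius `ε` about `z` while in `R`,
then `‖v x₀ - z‖ ≤ T (1 + ‖v x₀‖)` where `T` is independent of `v x₀` and `E (T ^ d) = O(ε ^ d)`.
The probability that `‖v x₀ - z‖ ≤ a (1 + ‖v x₀‖)` is `O(a ^ d)` uniformly in `z`: the Gaussian
density decays fast enough to compensate the growth of the radius
(`measure_norm_sub_le_mul_one_add_norm_le`). Integrating over the law of `T` gives the estimate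
for boxes (`exists_measure_hitEvent_ball_le`).

*Covering.* The set `I` meets `O(ε ^ (-m / δ))` boxes, so the probability that `v` hits a given
ball of radius `ε` while in `I` is `O(ε ^ (d - m / δ))`; summing over a covering of `A` by balls
gives the bound by the Hausdorff measure (`measure_hitEvent_le_ballHausdorff`).
-/

/-! ### Averages over pairs of sets -/

section Chaining

variable {m : ℕ} {F : Type*} [NormedAddCommGroup F]

theorem lintegral_enorm_sub_le_add {α : Type*} [MeasurableSpace α] (μ ν : Measure α)
    [IsProbabilityMeasure μ] [IsProbabilityMeasure ν] (f : α → F)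
    (hf : ∀ a, Measurable fun y => ‖f y - a‖ₑ) (a : F) :
    ∫⁻ y, ‖f y - a‖ₑ ∂μ ≤
      (∫⁻ y, ∫⁻ y', ‖f y - f y'‖ₑ ∂ν ∂μ) + ∫⁻ y', ‖f y' - a‖ₑ ∂ν := by
  have key : ∀ y, ‖f y - a‖ₑ ≤ (∫⁻ y', ‖f y - f y'‖ₑ ∂ν) + ∫⁻ y', ‖f y' - a‖ₑ ∂ν := by
    intro y
    calc ‖f y - a‖ₑ = ∫⁻ _, ‖f y - a‖ₑ ∂ν := by simp
      _ ≤ ∫⁻ y', (‖f y - f y'‖ₑ + ‖f y' - a‖ₑ) ∂ν := by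
          refine lintegral_mono fun y' => ?_
          have : f y - a = (f y - f y') + (f y' - a) := by abel
          rw [this]
          exact enorm_add_le _ _
      _ = _ := lintegral_add_right _ (hf a)
  calc ∫⁻ y, ‖f y - a‖ₑ ∂μ
      ≤ ∫⁻ y, ((∫⁻ y', ‖f y - f y'‖ₑ ∂ν) + ∫⁻ y', ‖f y' - a‖ₑ ∂ν) ∂μ := lintegral_mono key
    _ = _ := by rw [lintegral_add_right _ measurable_const]; simp

/-- This linear bound in `exp u`, where `u` is the `δ`-Hölder quotient, plays the part of Jensen's
inequality: it follows from `u - l ≤ exp (u - l)` and is integrated with `l` the logarithm of the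
mean of `exp u`. -/
theorem norm_sub_le_rpow_mul_exp {E : Type*} [NormedAddCommGroup E] {δ r l : ℝ} (hδ : 0 < δ)
    (f : E → F) {y y' : E} (h : ‖y - y'‖ ≤ r) (hl : 0 ≤ l) :
    ‖f y - f y'‖ ≤
      r ^ δ * (l + Real.exp (-l) * Real.exp (‖f y - f y'‖ / ‖y - y'‖ ^ δ)) := by
  have hr : 0 ≤ r := (norm_nonneg _).trans h
  rcases eq_or_ne y y' with rfl | hne
  · simp only [sub_self, norm_zero]
    positivity
  have hpos : 0 < ‖y - y'‖ := norm_pos_iff.2 (sub_ne_zero.2 hne)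
  set u := ‖f y - f y'‖ / ‖y - y'‖ ^ δ with hu
  have hu0 : 0 ≤ u := by positivity
  have h1 : ‖f y - f y'‖ = ‖y - y'‖ ^ δ * u := by
    rw [hu]; field_simp
  have h2 : u ≤ l + Real.exp (-l) * Real.exp u := by
    rw [← Real.exp_add]
    have := Real.add_one_le_exp (-l + u)
    linarith
  rw [h1]
  exact mul_le_mul (Real.rpow_le_rpow hpos.le h hδ.le) h2 hu0 (by positivity)

theorem lintegral_cond {α : Type*} [MeasurableSpace α] (μ : Measure α) (s : Set α)
    (g : α → ℝ≥0∞) : ∫⁻ y, g y ∂(cond μ s) = (μ s)⁻¹ * ∫⁻ y in s, g y ∂μ := by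
  rw [ProbabilityTheory.cond, lintegral_smul_measure, smul_eq_mul]

variable {δ : ℝ} {f : EuclideanSpace ℝ (Fin m) → F}

theorem measurable_exp_quotient (δ : ℝ) (hf : Continuous f) :
    Measurable fun p : EuclideanSpace ℝ (Fin m) × EuclideanSpace ℝ (Fin m) =>
      ENNReal.ofReal (Real.exp (‖f p.1 - f p.2‖ / ‖p.1 - p.2‖ ^ δ)) := by
  have h1 : Continuous fun p : EuclideanSpace ℝ (Fin m) × EuclideanSpace ℝ (Fin m) =>
    ‖f p.1 - f p.2‖ := by fun_prop
  have h2 : Continuous fun p : EuclideanSpace ℝ (Fin m) × EuclideanSpace ℝ (Fin m) =>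
    ‖p.1 - p.2‖ := by fun_prop
  exact (Real.measurable_exp.comp (h1.measurable.div (h2.measurable.pow_const δ))).ennreal_ofReal

/-- The mean oscillation between two subsets of `R` is controlled by the logarithm `l` of the mean
exponential Hölder quotient over `R × R`, renormalised to these subsets. -/
theorem lintegral_cond_lintegral_cond_enorm_sub_le (hδ : 0 < δ) (hf : Continuous f)
    {Q Q' R : Set (EuclideanSpace ℝ (Fin m))} (hQ : IsCompact Q) (hQ' : IsCompact Q')
    (hQR : Q ⊆ R) (hQR' : Q' ⊆ R) (hQ0 : volume Q ≠ 0) (hQ0' : volume Q' ≠ 0) {r l : ℝ}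
    (hl : 0 ≤ l) (hr : 0 ≤ r) (hdist : ∀ y ∈ Q, ∀ y' ∈ Q', ‖y - y'‖ ≤ r)
    (hB : ∫⁻ y in R, ∫⁻ y' in R, ENNReal.ofReal (Real.exp (‖f y - f y'‖ / ‖y - y'‖ ^ δ)) ≤
      ENNReal.ofReal (Real.exp l) * (volume Q * volume Q')) :
    ∫⁻ y, ∫⁻ y', ‖f y - f y'‖ₑ ∂(cond volume Q') ∂(cond volume Q) ≤
      ENNReal.ofReal (r ^ δ * (l + 1)) := by
  have hQt := hQ.measure_ne_top (μ := volume)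
  have hQt' := hQ'.measure_ne_top (μ := volume)
  have := cond_isProbabilityMeasure_of_finite hQ0 hQt
  have := cond_isProbabilityMeasure_of_finite hQ0' hQt'
  have hm := measurable_exp_quotient δ hf
  set e : EuclideanSpace ℝ (Fin m) → EuclideanSpace ℝ (Fin m) → ℝ≥0∞ := fun y y' =>
    ENNReal.ofReal (Real.exp (‖f y - f y'‖ / ‖y - y'‖ ^ δ)) with he
  have hm1 : ∀ y, Measurable (e y) := fun y => hm.comp measurable_prodMk_left
  have hm2 : Measurable fun y => ∫⁻ y' in Q', e y y' := hm.lintegral_prod_right'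
  have hpt : ∀ y ∈ Q, ∀ y' ∈ Q', ‖f y - f y'‖ₑ ≤
      ENNReal.ofReal (r ^ δ) * (ENNReal.ofReal l + ENNReal.ofReal (Real.exp (-l)) * e y y') := by
    intro y hy y' hy'
    rw [← ENNReal.ofReal_mul (Real.exp_nonneg _), ← ENNReal.ofReal_add hl (by positivity),
      ← ENNReal.ofReal_mul (by positivity), ← ofReal_norm]
    exact ENNReal.ofReal_le_ofReal (norm_sub_le_rpow_mul_exp hδ f (hdist y hy y' hy') hl)
  have hBQ : (volume Q)⁻¹ * ((volume Q')⁻¹ * ∫⁻ y in Q, ∫⁻ y' in Q', e y y') ≤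
      ENNReal.ofReal (Real.exp l) := by
    have h1 : ∫⁻ y in Q, ∫⁻ y' in Q', e y y' ≤ ∫⁻ y in R, ∫⁻ y' in R, e y y' :=
      (lintegral_mono fun y => lintegral_mono_set hQR').trans (lintegral_mono_set hQR)
    calc _ ≤ (volume Q)⁻¹ * ((volume Q')⁻¹ *
          (ENNReal.ofReal (Real.exp l) * (volume Q * volume Q'))) := by
            gcongr; exact h1.trans hB
      _ = ENNReal.ofReal (Real.exp l) * ((volume Q)⁻¹ * volume Q) *
          ((volume Q')⁻¹ * volume Q') := by ring
      _ = _ := by rw [ENNReal.inv_mul_cancel hQ0 hQt, ENNReal.inv_mul_cancel hQ0' hQt']; simp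
  have hin : ∀ y ∈ Q, ∫⁻ y', ‖f y - f y'‖ₑ ∂(cond volume Q') ≤
      ENNReal.ofReal (r ^ δ) * (ENNReal.ofReal l + ENNReal.ofReal (Real.exp (-l)) *
        ((volume Q')⁻¹ * ∫⁻ y' in Q', e y y')) := by
    intro y hy
    calc _ ≤ ∫⁻ y', ENNReal.ofReal (r ^ δ) *
          (ENNReal.ofReal l + ENNReal.ofReal (Real.exp (-l)) * e y y') ∂(cond volume Q') := by
            refine lintegral_mono_ae ?_
            filter_upwards [ae_cond_mem hQ'.measurableSet] with y' hy' using hpt y hy y' hy'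
      _ = _ := by
        rw [lintegral_const_mul _ (by fun_prop), lintegral_add_left (by fun_prop),
          lintegral_const_mul _ (by fun_prop), lintegral_const, measure_univ, mul_one,
          lintegral_cond]
  calc _ ≤ ∫⁻ y, ENNReal.ofReal (r ^ δ) * (ENNReal.ofReal l + ENNReal.ofReal (Real.exp (-l)) *
        ((volume Q')⁻¹ * ∫⁻ y' in Q', e y y')) ∂(cond volume Q) := by
            refine lintegral_mono_ae ?_
            filter_upwards [ae_cond_mem hQ.measurableSet] with y hy using hin y hy
    _ = ENNReal.ofReal (r ^ δ) * (ENNReal.ofReal l + ENNReal.ofReal (Real.exp (-l)) *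
        ((volume Q)⁻¹ * ((volume Q')⁻¹ * ∫⁻ y in Q, ∫⁻ y' in Q', e y y'))) := by
        rw [lintegral_const_mul _ (by fun_prop), lintegral_add_left (by fun_prop),
          lintegral_const_mul _ (by fun_prop), lintegral_const_mul _ (by fun_prop), lintegral_const,
          measure_univ, mul_one, lintegral_cond, mul_left_comm (volume Q)⁻¹]
    _ ≤ ENNReal.ofReal (r ^ δ) * (ENNReal.ofReal l + ENNReal.ofReal (Real.exp (-l)) *
        ENNReal.ofReal (Real.exp l)) := by gcongr
    _ = _ := by
      rw [← ENNReal.ofReal_mul (Real.exp_nonneg _), ← Real.exp_add]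
      simp only [neg_add_cancel, Real.exp_zero]
      rw [← ENNReal.ofReal_add hl zero_le_one, ← ENNReal.ofReal_mul (by positivity)]

end Chaining

/-! ### Modulus of continuity by chaining -/

section Modulus

variable {m : ℕ} {F : Type*} [NormedAddCommGroup F]

theorem volume_homothety (x : EuclideanSpace ℝ (Fin m)) {t : ℝ} (ht : 0 ≤ t)
    (R : Set (EuclideanSpace ℝ (Fin m))) :
    volume (AffineMap.homothety x t '' R) = ENNReal.ofReal (t ^ m) * volume R := by
  rw [Measure.addHaar_image_homothety]
  simp [abs_of_nonneg (pow_nonneg ht m)]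

/-- The sum over the scales `2 ^ (-n)` of the oscillation allowed at each scale. The factor `1 +
(2 * n + 1) * m * log 2` is the logarithm lost when the double integral over `R × R` is normalised
by the volumes of the copies of `R` of ratios `2 ^ (-n)` and `2 ^ (-(n + 1))`. -/
noncomputable def chainingConst (m : ℕ) (δ : ℝ) : ℝ :=
  ∑' n : ℕ, ((2⁻¹ : ℝ) ^ δ) ^ n * (1 + (2 * n + 1) * (m * Real.log 2))

theorem chainingConst_nonneg (m : ℕ) (δ : ℝ) : 0 ≤ chainingConst m δ :=
  tsum_nonneg fun n => by
    have : 0 ≤ Real.log 2 := Real.log_nonneg one_le_two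
    positivity

theorem chainingConst_summable (m : ℕ) {δ : ℝ} (hδ : 0 < δ) :
    Summable fun n : ℕ => ((2⁻¹ : ℝ) ^ δ) ^ n * (1 + (2 * n + 1) * (m * Real.log 2)) := by
  have hq0 : 0 ≤ (2⁻¹ : ℝ) ^ δ := by positivity
  have hq1 : (2⁻¹ : ℝ) ^ δ < 1 := Real.rpow_lt_one (by norm_num) (by norm_num) hδ
  have h1 := summable_geometric_of_lt_one hq0 hq1
  have h2 := summable_pow_mul_geometric_of_norm_lt_one (R := ℝ) 1
    (r := (2⁻¹ : ℝ) ^ δ) (by rwa [Real.norm_of_nonneg hq0])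
  refine ((h1.mul_right (1 + m * Real.log 2)).add
    (h2.mul_right (2 * (m * Real.log 2)))).congr fun n => ?_
  ring

variable {δ : ℝ} {f : EuclideanSpace ℝ (Fin m) → F}

/-- The mean deviation from the value at `x`, bounded by telescoping over the homothetic copies of
`R` with centre `x`. -/
theorem lintegral_cond_enorm_sub_le (hδ : 0 < δ) (hf : Continuous f)
    {R : Set (EuclideanSpace ℝ (Fin m))} (hR : IsCompact R) (hRc : Convex ℝ R)
    (hR0 : volume R ≠ 0) {ρ b : ℝ} (hdiam : ∀ y ∈ R, ∀ y' ∈ R, ‖y - y'‖ ≤ ρ) (hb : 1 ≤ b)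
    (hB : ∫⁻ y in R, ∫⁻ y' in R, ENNReal.ofReal (Real.exp (‖f y - f y'‖ / ‖y - y'‖ ^ δ)) ≤
      ENNReal.ofReal b * volume R ^ 2) {x : EuclideanSpace ℝ (Fin m)} (hx : x ∈ R) :
    ∫⁻ y, ‖f y - f x‖ₑ ∂(cond volume R) ≤
      ENNReal.ofReal ((2 * ρ) ^ δ * (1 + Real.log b) * chainingConst m δ) := by
  have hρ : 0 ≤ ρ := (norm_nonneg _).trans (hdiam x hx x hx)
  have hRt := hR.measure_ne_top (μ := volume)
  have hlogb : 0 ≤ Real.log b := Real.log_nonneg hb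
  have hlog2 : 0 ≤ Real.log 2 := Real.log_nonneg one_le_two
  set q : ℝ := (2⁻¹ : ℝ) ^ δ with hq
  set Q : ℕ → Set (EuclideanSpace ℝ (Fin m)) := fun n =>
    AffineMap.homothety x ((2⁻¹ : ℝ) ^ n) '' R with hQdef
  have hQc : ∀ n, IsCompact (Q n) := fun n =>
    hR.image (AffineMap.homothety_continuous x _)
  have hQR : ∀ n, Q n ⊆ R := by
    rintro n _ ⟨a, ha, rfl⟩
    rw [AffineMap.homothety_eq_lineMap]
    exact hRc.lineMap_mem hx ha ⟨by positivity, pow_le_one₀ (by norm_num) (by norm_num)⟩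
  have hQv : ∀ n, volume (Q n) = ENNReal.ofReal (((2⁻¹ : ℝ) ^ n) ^ m) * volume R := fun n =>
    volume_homothety x (by positivity) R
  have hQ0 : ∀ n, volume (Q n) ≠ 0 := fun n => by
    rw [hQv]
    exact mul_ne_zero (by simp) hR0
  have hQx : ∀ n, ∀ y ∈ Q n, ‖y - x‖ ≤ (2⁻¹ : ℝ) ^ n * ρ := by
    rintro n _ ⟨a, ha, rfl⟩
    simp only [AffineMap.homothety_apply, vsub_eq_sub, vadd_eq_add, add_sub_cancel_right,
      norm_smul, Real.norm_eq_abs]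
    rw [abs_of_nonneg (by positivity)]
    exact mul_le_mul_of_nonneg_left (hdiam a ha x hx) (by positivity)
  have hP : ∀ n, IsProbabilityMeasure (cond volume (Q n)) := fun n =>
    cond_isProbabilityMeasure_of_finite (hQ0 n) (hQc n).measure_ne_top
  set M : ℕ → ℝ := fun n => (2 * ρ) ^ δ * (1 + Real.log b) *
    (q ^ n * (1 + (2 * n + 1) * (m * Real.log 2))) with hM
  have hM0 : ∀ n, 0 ≤ M n := fun n => by positivity
  have hstep : ∀ n, ∫⁻ y, ‖f y - f x‖ₑ ∂(cond volume (Q n)) ≤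
      ENNReal.ofReal (M n) + ∫⁻ y, ‖f y - f x‖ₑ ∂(cond volume (Q (n + 1))) := by
    intro n
    refine (lintegral_enorm_sub_le_add _ (cond volume (Q (n + 1))) f
      (fun a => (hf.sub continuous_const).enorm.measurable) (f x)).trans ?_
    gcongr
    have hl : 0 ≤ Real.log b + (2 * n + 1) * (m * Real.log 2) := by positivity
    refine (lintegral_cond_lintegral_cond_enorm_sub_le hδ hf (hQc n) (hQc (n + 1)) (hQR n)
      (hQR _) (hQ0 n) (hQ0 _) (r := (2⁻¹ : ℝ) ^ n * (2 * ρ)) hl (by positivity) ?_ ?_).trans ?_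
    · intro y hy y' hy'
      have h1 := hQx n y hy
      have h2 := hQx (n + 1) y' hy'
      have h3 : (2⁻¹ : ℝ) ^ (n + 1) * ρ ≤ (2⁻¹ : ℝ) ^ n * ρ := by
        gcongr ?_ * _
        exact pow_le_pow_of_le_one (by norm_num) (by norm_num) n.le_succ
      have h4 : ‖y - y'‖ ≤ ‖y - x‖ + ‖y' - x‖ := by
        rw [← norm_sub_rev x y']; exact norm_sub_le_norm_sub_add_norm_sub _ _ _
      linarith
    · refine hB.trans (le_of_eq ?_)
      have hexp : Real.exp (Real.log b + (2 * n + 1) * (m * Real.log 2)) =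
          b * 2 ^ ((2 * n + 1) * m) := by
        rw [Real.exp_add, Real.exp_log (by linarith)]
        congr 1
        rw [← Real.exp_log (show (0 : ℝ) < 2 by norm_num), ← Real.exp_nat_mul, Real.exp_log two_pos]
        push_cast; ring_nf
      rw [hexp, hQv, hQv, show ∀ a c d V : ℝ≥0∞, a * (c * V * (d * V)) = (a * (c * d)) * V ^ 2 by
        intros; ring, ← ENNReal.ofReal_mul (by positivity), ← ENNReal.ofReal_mul (by positivity)]
      congr 2
      rw [← pow_mul, ← pow_mul, ← pow_add, show n * m + (n + 1) * m = (2 * n + 1) * m by ring,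
        mul_assoc, ← mul_pow]
      norm_num
    · refine ENNReal.ofReal_le_ofReal ?_
      rw [Real.mul_rpow (by positivity) (by positivity), ← Real.rpow_natCast, ← Real.rpow_mul
        (by norm_num), mul_comm (n : ℝ), Real.rpow_mul (by norm_num), Real.rpow_natCast, ← hq, hM]
      have h1 : Real.log b + (2 * n + 1) * (m * Real.log 2) + 1 ≤
          (1 + Real.log b) * (1 + (2 * n + 1) * (m * Real.log 2)) := by
        have : 0 ≤ Real.log b * ((2 * n + 1) * (m * Real.log 2)) := by positivity
        linarith
      calc _ ≤ q ^ n * (2 * ρ) ^ δ * ((1 + Real.log b) * (1 + (2 * n + 1) * (m * Real.log 2))) := by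
            gcongr
        _ = _ := by ring
  have hind : ∀ N, ∫⁻ y, ‖f y - f x‖ₑ ∂(cond volume (Q 0)) ≤
      ENNReal.ofReal (∑ n ∈ Finset.range N, M n) +
        ∫⁻ y, ‖f y - f x‖ₑ ∂(cond volume (Q N)) := by
    intro N
    induction N with
    | zero => simp
    | succ N ih =>
      refine ih.trans ?_
      rw [Finset.sum_range_succ, ENNReal.ofReal_add (Finset.sum_nonneg fun n _ => hM0 n) (hM0 N),
        add_assoc]
      gcongr
      exact hstep N
  have hQ00 : Q 0 = R := by simp [hQdef]
  have hsum : Summable M := (chainingConst_summable m hδ).mul_left _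
  have htsum : ∑' n, M n = (2 * ρ) ^ δ * (1 + Real.log b) * chainingConst m δ := tsum_mul_left
  rw [← htsum, ← hQ00]
  -- By continuity the averages over the shrinking copies of `R` tend to the value at `x`.
  refine ENNReal.le_of_forall_pos_le_add fun e he _ => ?_
  obtain ⟨η, hη, hfη⟩ := Metric.continuousAt_iff.1 (hf.continuousAt (x := x)) e he
  have hlim : Tendsto (fun n : ℕ => (2⁻¹ : ℝ) ^ n * ρ) atTop (𝓝 0) := by
    simpa using (tendsto_pow_atTop_nhds_zero_of_lt_one (r := (2⁻¹ : ℝ)) (by norm_num)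
      (by norm_num)).mul_const ρ
  obtain ⟨N, hN⟩ := (hlim.eventually (gt_mem_nhds hη)).exists
  refine (hind N).trans (add_le_add (ENNReal.ofReal_le_ofReal
    (hsum.sum_le_tsum _ fun n _ => hM0 n)) ?_)
  calc _ ≤ ∫⁻ _, (e : ℝ≥0∞) ∂(cond volume (Q N)) := by
        refine lintegral_mono_ae ?_
        filter_upwards [ae_cond_mem (hQc N).measurableSet] with y hy
        have := hfη (x := y) (by rw [dist_eq_norm]; exact (hQx N y hy).trans_lt hN)
        rw [dist_eq_norm] at this
        rw [← ofReal_norm, ← ENNReal.ofReal_coe_nnreal]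
        exact ENNReal.ofReal_le_ofReal this.le
    _ = e := by simp

/-- The Garsia-Rodemich-Rumsey inequality on a compact convex set, for the Young function `exp`. -/
theorem norm_sub_le_of_lintegral_exp_le (hδ : 0 < δ) (hf : Continuous f)
    {R : Set (EuclideanSpace ℝ (Fin m))} (hR : IsCompact R) (hRc : Convex ℝ R)
    (hR0 : volume R ≠ 0) {ρ b : ℝ} (hdiam : ∀ y ∈ R, ∀ y' ∈ R, ‖y - y'‖ ≤ ρ) (hb : 1 ≤ b)
    (hB : ∫⁻ y in R, ∫⁻ y' in R, ENNReal.ofReal (Real.exp (‖f y - f y'‖ / ‖y - y'‖ ^ δ)) ≤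
      ENNReal.ofReal b * volume R ^ 2) {x x' : EuclideanSpace ℝ (Fin m)} (hx : x ∈ R)
    (hx' : x' ∈ R) :
    ‖f x - f x'‖ ≤ 2 * (2 * ρ) ^ δ * chainingConst m δ * (1 + Real.log b) := by
  have hρ : 0 ≤ ρ := (norm_nonneg _).trans (hdiam x hx x hx)
  have hlogb : 0 ≤ Real.log b := Real.log_nonneg hb
  have hK : 0 ≤ chainingConst m δ := chainingConst_nonneg m δ
  have := cond_isProbabilityMeasure_of_finite hR0 (hR.measure_ne_top (μ := volume))
  have h1 := lintegral_cond_enorm_sub_le hδ hf hR hRc hR0 hdiam hb hB hx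
  have h2 := lintegral_cond_enorm_sub_le hδ hf hR hRc hR0 hdiam hb hB hx'
  have h3 : ‖f x - f x'‖ₑ ≤ ∫⁻ y, ‖f y - f x‖ₑ ∂(cond volume R) +
      ∫⁻ y, ‖f y - f x'‖ₑ ∂(cond volume R) := by
    have hmx : Measurable fun y => ‖f y - f x‖ₑ := (hf.sub continuous_const).enorm.measurable
    rw [← lintegral_add_left hmx]
    calc ‖f x - f x'‖ₑ = ∫⁻ _, ‖f x - f x'‖ₑ ∂(cond volume R) := by simp
      _ ≤ _ := lintegral_mono fun y => by
        rw [show f x - f x' = (f y - f x') - (f y - f x) by abel, add_comm]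
        exact enorm_sub_le
  have h4 := h3.trans (add_le_add h1 h2)
  rw [← ENNReal.ofReal_add (by positivity) (by positivity), ← ofReal_norm,
    ENNReal.ofReal_le_ofReal_iff (by positivity)] at h4
  linarith

theorem one_add_log_pow_le {b : ℝ} (hb : 1 ≤ b) {p : ℕ} (hp : p ≠ 0) :
    (1 + Real.log b) ^ p ≤ (p : ℝ) ^ p * b := by
  have hp1 : (1 : ℝ) ≤ p := by exact_mod_cast Nat.one_le_iff_ne_zero.2 hp
  have hp0 : (0 : ℝ) < p := by linarith
  have hb0 : 0 < b := by linarith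
  have h1 : Real.log b / p ≤ b ^ ((p : ℝ)⁻¹) - 1 := by
    have := Real.log_le_sub_one_of_pos (Real.rpow_pos_of_pos hb0 ((p : ℝ)⁻¹))
    rwa [Real.log_rpow hb0, inv_mul_eq_div] at this
  have h2 : 1 + Real.log b ≤ p * b ^ ((p : ℝ)⁻¹) := by
    rw [div_le_iff₀ hp0] at h1
    linarith
  calc _ ≤ (p * b ^ ((p : ℝ)⁻¹)) ^ p := by
        gcongr
        have := Real.log_nonneg hb
        linarith
    _ = _ := by rw [mul_pow, Real.rpow_inv_natCast_pow hb0.le hp]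

/-- The modulus of continuity in a form that is linear in the double integral, so that it can be
integrated over a probability space. Here a power of the logarithm is bounded by a linear
function. -/
theorem enorm_sub_pow_le_lintegral_exp (hδ : 0 < δ) (hf : Continuous f)
    {R : Set (EuclideanSpace ℝ (Fin m))} (hR : IsCompact R) (hRc : Convex ℝ R)
    (hR0 : volume R ≠ 0) {ρ : ℝ} (hρ : 0 < ρ) (hdiam : ∀ y ∈ R, ∀ y' ∈ R, ‖y - y'‖ ≤ ρ)
    {p : ℕ} (hp : p ≠ 0) {x x' : EuclideanSpace ℝ (Fin m)} (hx : x ∈ R) (hx' : x' ∈ R) :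
    ‖f x - f x'‖ₑ ^ p ≤
      ENNReal.ofReal ((p * (2 * (2 * ρ) ^ δ * (chainingConst m δ + 1))) ^ p) *
      ((∫⁻ y in R, ∫⁻ y' in R, ENNReal.ofReal (Real.exp (‖f y - f y'‖ / ‖y - y'‖ ^ δ))) /
        volume R ^ 2) := by
  have hK : 0 ≤ chainingConst m δ := chainingConst_nonneg m δ
  have hRt := hR.measure_ne_top (μ := volume)
  have hV0 : volume R ^ 2 ≠ 0 := pow_ne_zero 2 hR0
  have hVt : volume R ^ 2 ≠ ∞ := ENNReal.pow_ne_top hRt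
  set B := ∫⁻ y in R, ∫⁻ y' in R, ENNReal.ofReal (Real.exp (‖f y - f y'‖ / ‖y - y'‖ ^ δ)) with hBdef
  have hp0 : (0 : ℝ) < p := by exact_mod_cast Nat.pos_of_ne_zero hp
  -- If the double integral is infinite, the right-hand side is infinite.
  rcases eq_or_ne (B / volume R ^ 2) ∞ with htop | htop
  · rw [htop, ENNReal.mul_top]
    · exact le_top
    · simp only [ne_eq, ENNReal.ofReal_eq_zero, not_le]
      positivity
  have hB1 : 1 ≤ B / volume R ^ 2 := by
    rw [ENNReal.le_div_iff_mul_le (.inl hV0) (.inl hVt), one_mul]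
    calc volume R ^ 2 = ∫⁻ y in R, ∫⁻ y' in R, 1 := by simp [sq]
      _ ≤ B := lintegral_mono fun y => lintegral_mono fun y' => by
        rw [← ENNReal.ofReal_one]
        exact ENNReal.ofReal_le_ofReal (Real.one_le_exp (by positivity))
  set b := (B / volume R ^ 2).toReal with hb
  have hbB : ENNReal.ofReal b = B / volume R ^ 2 := ENNReal.ofReal_toReal htop
  have hb1 : 1 ≤ b := by
    rw [← ENNReal.ofReal_le_ofReal_iff (by positivity), hbB]
    simpa using hB1
  have h1 := norm_sub_le_of_lintegral_exp_le hδ hf hR hRc hR0 hdiam hb1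
    (by rw [hbB, ENNReal.div_mul_cancel hV0 hVt]) hx hx'
  rw [← hbB, ← ofReal_norm, ← ENNReal.ofReal_pow (norm_nonneg _),
    ← ENNReal.ofReal_mul (by positivity)]
  refine ENNReal.ofReal_le_ofReal ?_
  have hlog : 0 ≤ Real.log b := Real.log_nonneg hb1
  calc ‖f x - f x'‖ ^ p ≤ (2 * (2 * ρ) ^ δ * (chainingConst m δ + 1) * (1 + Real.log b)) ^ p := by
        gcongr
        refine h1.trans ?_
        gcongr
        linarith
    _ = (2 * (2 * ρ) ^ δ * (chainingConst m δ + 1)) ^ p * (1 + Real.log b) ^ p := mul_pow _ _ _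
    _ ≤ (2 * (2 * ρ) ^ δ * (chainingConst m δ + 1)) ^ p * ((p : ℝ) ^ p * b) := by
        gcongr
        exact one_add_log_pow_le hb1 hp
    _ = _ := by rw [mul_pow (p : ℝ)]; ring

end Modulus

/-! ### Gaussian anticoncentration and moments -/

section Anticoncentration

open scoped NNReal Nat

/-- A bound for `(1 + |x|) ^ d` times the centred Gaussian density at `x`, uniform over the
variances in `[s, V]`; see `gaussianPDFReal_mul_one_add_abs_pow_le`. -/
noncomputable def gaussianDecayConst (d : ℕ) (s V : ℝ) : ℝ :=
  (Real.sqrt (2 * Real.pi * s))⁻¹ * (d ! * Real.exp (1 + V / 2))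

theorem gaussianPDFReal_mul_one_add_abs_pow_le (d : ℕ) {s V : ℝ} (hs : 0 < s) {u : ℝ≥0}
    (hsu : s ≤ u) (huV : u ≤ V) (x : ℝ) :
    gaussianPDFReal 0 u x * (1 + |x|) ^ d ≤ gaussianDecayConst d s V := by
  have hu : (0 : ℝ) < u := hs.trans_le hsu
  rw [gaussianPDFReal, gaussianDecayConst, mul_assoc]
  have h1 : (1 + |x|) ^ d ≤ d ! * Real.exp (1 + |x|) := by
    have := Real.pow_div_factorial_le_exp (1 + |x|) (by positivity) d
    rwa [div_le_iff₀ (by positivity), mul_comm] at this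
  have h2 : -(x - 0) ^ 2 / (2 * u) + (1 + |x|) ≤ 1 + V / 2 := by
    have h3 : |x| - x ^ 2 / (2 * u) ≤ u / 2 := by
      rw [← sq_abs x, sub_le_iff_le_add, ← sub_nonneg]
      have : (u : ℝ) / 2 + |x| ^ 2 / (2 * u) - |x| = (u - |x|) ^ 2 / (2 * u) := by
        field_simp; ring
      rw [this]; positivity
    rw [sub_zero, neg_div]; linarith
  have h4 : Real.exp (-(x - 0) ^ 2 / (2 * u)) * (1 + |x|) ^ d ≤ d ! * Real.exp (1 + V / 2) := by
    calc Real.exp (-(x - 0) ^ 2 / (2 * u)) * (1 + |x|) ^ d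
        ≤ Real.exp (-(x - 0) ^ 2 / (2 * u)) * (d ! * Real.exp (1 + |x|)) := by gcongr
      _ = d ! * Real.exp (-(x - 0) ^ 2 / (2 * u) + (1 + |x|)) := by
          rw [Real.exp_add (-(x - 0) ^ 2 / (2 * u))]; ring
      _ ≤ _ := by gcongr
  refine mul_le_mul ?_ h4 (by positivity) (by positivity)
  gcongr

/-- The mass of an interval of half-length `r` on which `1 + |x|` is at least `h`. -/
theorem gaussianReal_Icc_le (d : ℕ) {s V : ℝ} (hs : 0 < s) {u : ℝ≥0} (hsu : s ≤ u) (huV : u ≤ V)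
    {t r h : ℝ} (hr : 0 ≤ r) (hh : 0 < h) (hdecay : ∀ x, |x - t| ≤ r → h ≤ 1 + |x|) :
    gaussianReal 0 u (Icc (t - r) (t + r)) ≤
      ENNReal.ofReal (2 * r * (gaussianDecayConst d s V / h ^ d)) := by
  have hu : (0 : ℝ) < u := hs.trans_le hsu
  rw [gaussianReal_apply 0 (by exact_mod_cast hu.ne')]
  calc _ ≤ ∫⁻ _ in Icc (t - r) (t + r), ENNReal.ofReal (gaussianDecayConst d s V / h ^ d) := by
        refine setLIntegral_mono' measurableSet_Icc fun x hx => ENNReal.ofReal_le_ofReal ?_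
        have hxt : h ≤ 1 + |x| := hdecay x (abs_le.2 ⟨by linarith [hx.1], by linarith [hx.2]⟩)
        rw [le_div_iff₀ (by positivity)]
        refine le_trans ?_ (gaussianPDFReal_mul_one_add_abs_pow_le d hs hsu huV x)
        have := gaussianPDFReal_nonneg 0 u x
        gcongr
    _ = _ := by
      rw [setLIntegral_const, Real.volume_Icc, mul_comm, ← ENNReal.ofReal_mul (by linarith)]
      congr 2; ring

variable {d : ℕ} {Ω : Type*} [MeasurableSpace Ω] {P : Measure Ω}

theorem norm_le_card_mul_of_abs_le {d : ℕ} (z : EuclideanSpace ℝ (Fin d)) {k : Fin d}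
    (hk : ∀ i, |z i| ≤ |z k|) : ‖z‖ ≤ d * |z k| := by
  calc ‖z‖ ≤ ∑ i, ‖z i‖ := by
        conv_lhs => rw [← (EuclideanSpace.basisFun (Fin d) ℝ).sum_repr z]
        refine (norm_sum_le _ _).trans (le_of_eq ?_)
        simp [norm_smul]
    _ ≤ ∑ _ : Fin d, |z k| := Finset.sum_le_sum fun i _ => hk i
    _ = _ := by simp

/-- Anticoncentration at a scale that grows with the Gaussian vector itself, uniform in `z`. For
small `a` the event forces every coordinate of `X` into an interval of half-length `2 * a * (1 +
‖z‖)`. On the largest coordinate of `z` the decay of the density supplies the factor `(1 + ‖z‖) ^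
(-d)`, which cancels the growth of all `d` intervals. -/
theorem measure_norm_sub_le_mul_one_add_norm_le [NeZero d] [IsProbabilityMeasure P] {s V : ℝ}
    (hs : 0 < s) {u : ℝ≥0} (hsu : s ≤ u) (huV : u ≤ V) {X : Ω → EuclideanSpace ℝ (Fin d)}
    (hX : Measurable X) (hlaw : ∀ i, P.map (fun ω => X ω i) = gaussianReal 0 u)
    (hindep : iIndepFun (fun i ω => X ω i) P) (z : EuclideanSpace ℝ (Fin d)) {a : ℝ} (ha : 0 ≤ a) :
    P {ω | ‖X ω - z‖ ≤ a * (1 + ‖X ω‖)} ≤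
      ENNReal.ofReal (((4 * d) ^ d + (8 * d * gaussianDecayConst d s V) ^ d) * a ^ d) := by
  have hd : (0 : ℝ) < d := by exact_mod_cast Nat.pos_of_ne_zero (NeZero.ne d)
  have hd1 : (1 : ℝ) ≤ d := by exact_mod_cast Nat.one_le_iff_ne_zero.2 (NeZero.ne d)
  set G := gaussianDecayConst d s V with hG
  have hG0 : 0 ≤ G := by rw [hG, gaussianDecayConst]; positivity
  -- For `a ≥ 1 / (4 * d)` the right-hand side is at least `1`.
  rcases le_or_gt (1 / (4 * d) : ℝ) a with hda | hda
  · refine prob_le_one.trans ?_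
    rw [← ENNReal.ofReal_one]
    refine ENNReal.ofReal_le_ofReal ?_
    have h1 : 1 ≤ 4 * (d : ℝ) * a := by
      rw [div_le_iff₀ (by positivity)] at hda; linarith
    have h2 : 1 ≤ (4 * (d : ℝ) * a) ^ d := one_le_pow₀ h1
    rw [mul_pow] at h2
    have : 0 ≤ (8 * d * G) ^ d * a ^ d := by positivity
    linarith
  have had : 4 * (d : ℝ) * a ≤ 1 := by
    rw [lt_div_iff₀ (by positivity)] at hda; linarith
  have ha4 : a ≤ 1 / 4 := by nlinarith
  set r := 2 * a * (1 + ‖z‖) with hr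
  have hr0 : 0 ≤ r := by positivity
  obtain ⟨k, -, hk⟩ := Finset.exists_max_image (Finset.univ : Finset (Fin d)) (fun i => |z i|)
    ⟨0, Finset.mem_univ 0⟩
  have hzk : ‖z‖ ≤ d * |z k| := norm_le_card_mul_of_abs_le z fun i => hk i (Finset.mem_univ i)
  -- A lower bound for `1 + |x|` on the interval about the largest coordinate of `z`.
  set h : ℝ := (1 + ‖z‖) / (2 * d) with hh
  have hh0 : 0 < h := by positivity
  have hsub : {ω | ‖X ω - z‖ ≤ a * (1 + ‖X ω‖)} ⊆
      ⋂ i ∈ (Finset.univ : Finset (Fin d)), (fun ω => X ω i) ⁻¹' Icc (z i - r) (z i + r) := by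
    intro ω hω
    simp only [mem_ofPred_eq] at hω
    have h1 : ‖X ω‖ ≤ ‖X ω - z‖ + ‖z‖ := norm_le_norm_sub_add _ _
    have h2 : ‖X ω - z‖ ≤ r := by
      rw [hr]
      nlinarith [norm_nonneg (X ω), norm_nonneg z]
    simp only [mem_iInter, mem_preimage]
    intro i _
    have h3 : |X ω i - z i| ≤ r := by
      have := PiLp.norm_apply_le (X ω - z) i
      simp only [PiLp.sub_apply, Real.norm_eq_abs] at this
      linarith
    rw [abs_le] at h3
    exact ⟨by linarith [h3.1], by linarith [h3.2]⟩
  have hmi : ∀ i, Measurable fun ω => X ω i := fun i => by fun_prop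
  have hprob : ∀ i, P ((fun ω => X ω i) ⁻¹' Icc (z i - r) (z i + r)) =
      gaussianReal 0 u (Icc (z i - r) (z i + r)) := fun i => by
    rw [← hlaw i, Measure.map_apply (hmi i) measurableSet_Icc]
  have hbd : ∀ i, P ((fun ω => X ω i) ⁻¹' Icc (z i - r) (z i + r)) ≤
      ENNReal.ofReal (2 * r * (G / (if i = k then h else 1) ^ d)) := by
    intro i
    rw [hprob]
    refine gaussianReal_Icc_le d hs hsu huV hr0 (by split_ifs <;> positivity) fun x hx => ?_
    split_ifs with hik
    · subst hik
      have h1 : |z i| ≤ |x| + r := by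
        have := abs_sub_abs_le_abs_sub (z i) x
        rw [abs_sub_comm] at this
        linarith
      have h2 : ‖z‖ / d ≤ |z i| := by rw [div_le_iff₀ hd]; linarith
      have h3 : 2 * a ≤ 1 / (2 * d) := by rw [le_div_iff₀ (by positivity)]; linarith
      have h4 : r ≤ (1 + ‖z‖) / (2 * d) := by
        rw [hr, div_eq_mul_one_div, mul_comm]
        gcongr
      have h5 : (1 + ‖z‖) / (2 * d) + (1 + ‖z‖) / (2 * d) = 1 / d + ‖z‖ / d := by
        field_simp; ring
      have h6 : 1 / (d : ℝ) ≤ 1 := by rw [div_le_iff₀ hd]; linarith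
      rw [hh]; linarith
    · linarith [abs_nonneg x]
  calc P {ω | ‖X ω - z‖ ≤ a * (1 + ‖X ω‖)}
      ≤ P (⋂ i ∈ (Finset.univ : Finset (Fin d)),
          (fun ω => X ω i) ⁻¹' Icc (z i - r) (z i + r)) := measure_mono hsub
    _ = ∏ i, P ((fun ω => X ω i) ⁻¹' Icc (z i - r) (z i + r)) :=
        hindep.measure_inter_preimage_eq_mul Finset.univ fun i _ => measurableSet_Icc
    _ ≤ ∏ i, ENNReal.ofReal (2 * r * (G / (if i = k then h else 1) ^ d)) :=
        Finset.prod_le_prod' fun i _ => hbd i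
    _ = ENNReal.ofReal ((8 * d * G) ^ d * a ^ d) := by
        rw [← ENNReal.ofReal_prod_of_nonneg fun i _ => by split_ifs <;> positivity]
        congr 1
        have : ∀ i, 2 * r * (G / (if i = k then h else 1) ^ d) =
            2 * r * G * (if i = k then (h ^ d)⁻¹ else 1) := by
          intro i; split_ifs
          · ring
          · simp
        simp only [this]
        rw [Finset.prod_mul_distrib]
        simp only [Finset.prod_const, Finset.card_univ, Fintype.card_fin, Finset.prod_ite_eq',
          Finset.mem_univ, if_true]
        rw [← inv_pow, ← mul_pow, ← mul_pow, hh, hr]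
        congr 1
        have : 1 + ‖z‖ ≠ 0 := by positivity
        field_simp
        ring
    _ ≤ _ := by
        refine ENNReal.ofReal_le_ofReal ?_
        have : 0 ≤ (4 * d : ℝ) ^ d * a ^ d := by positivity
        linarith

theorem lintegral_abs_pow_gaussianReal_le (d : ℕ) {V : ℝ} {u : ℝ≥0} (huV : u ≤ V) :
    ∫⁻ t, ‖t‖ₑ ^ d ∂(gaussianReal 0 u) ≤ ENNReal.ofReal (d ! * (2 * Real.exp (V / 2))) := by
  have hexp : ∀ c : ℝ, c ^ 2 = 1 → ∫⁻ t, ENNReal.ofReal (Real.exp (c * t)) ∂(gaussianReal 0 u) ≤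
      ENNReal.ofReal (Real.exp (V / 2)) := by
    intro c hc
    rw [← ofReal_integral_eq_lintegral_ofReal (integrable_exp_mul_gaussianReal c)
      (ae_of_all _ fun t => (Real.exp_pos _).le)]
    refine ENNReal.ofReal_le_ofReal ?_
    have := mgf_gaussianReal (p := gaussianReal 0 u) (X := id) (μ := 0) (v := u) (by simp) c
    simp only [mgf, id] at this
    rw [this, hc]
    gcongr
    linarith
  calc ∫⁻ t, ‖t‖ₑ ^ d ∂(gaussianReal 0 u)
      ≤ ∫⁻ t, ENNReal.ofReal (d !) * (ENNReal.ofReal (Real.exp (1 * t)) +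
          ENNReal.ofReal (Real.exp (-1 * t))) ∂(gaussianReal 0 u) := by
        refine lintegral_mono fun t => ?_
        rw [← ofReal_norm, ← ENNReal.ofReal_pow (norm_nonneg _),
          ← ENNReal.ofReal_add (by positivity) (by positivity), ← ENNReal.ofReal_mul (by positivity)]
        refine ENNReal.ofReal_le_ofReal ?_
        have h1 := Real.pow_div_factorial_le_exp |t| (by positivity) d
        rw [div_le_iff₀ (by positivity), mul_comm] at h1
        refine h1.trans ?_
        gcongr
        rcases abs_cases t with ⟨h, _⟩ | ⟨h, _⟩ <;> rw [h]
        · simp; positivity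
        · simp; positivity
    _ = ENNReal.ofReal (d !) * (∫⁻ t, ENNReal.ofReal (Real.exp (1 * t)) ∂(gaussianReal 0 u) +
          ∫⁻ t, ENNReal.ofReal (Real.exp (-1 * t)) ∂(gaussianReal 0 u)) := by
        rw [lintegral_const_mul _ (by fun_prop), lintegral_add_left (by fun_prop)]
    _ ≤ ENNReal.ofReal (d !) * (ENNReal.ofReal (Real.exp (V / 2)) +
          ENNReal.ofReal (Real.exp (V / 2))) := by
        gcongr
        · exact hexp 1 (by norm_num)
        · exact hexp (-1) (by norm_num)
    _ = _ := by
        rw [← ENNReal.ofReal_add (by positivity) (by positivity),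
          ← ENNReal.ofReal_mul (by positivity), two_mul]

theorem lintegral_enorm_pow_le_of_gaussian [NeZero d] [IsProbabilityMeasure P] {V : ℝ} {u : ℝ≥0}
    (huV : u ≤ V) {X : Ω → EuclideanSpace ℝ (Fin d)}
    (hX : Measurable X) (hlaw : ∀ i, P.map (fun ω => X ω i) = gaussianReal 0 u) :
    ∫⁻ ω, ‖X ω‖ₑ ^ d ∂P ≤ ENNReal.ofReal (d ^ d * (d * (d ! * (2 * Real.exp (V / 2))))) := by
  have hmi : ∀ i, Measurable fun ω => X ω i := fun i => by fun_prop
  have hpt : ∀ z : EuclideanSpace ℝ (Fin d), ‖z‖ₑ ^ d ≤ ENNReal.ofReal (d ^ d) *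
      ∑ i, ‖z i‖ₑ ^ d := by
    intro z
    obtain ⟨k, -, hk⟩ := Finset.exists_max_image (Finset.univ : Finset (Fin d)) (fun i => |z i|)
      ⟨0, Finset.mem_univ 0⟩
    have hzk : ‖z‖ ≤ d * |z k| := norm_le_card_mul_of_abs_le z fun i => hk i (Finset.mem_univ i)
    calc ‖z‖ₑ ^ d ≤ ENNReal.ofReal (d ^ d) * ‖z k‖ₑ ^ d := by
          rw [← ofReal_norm, ← ofReal_norm, ← ENNReal.ofReal_pow (norm_nonneg _),
            ← ENNReal.ofReal_pow (norm_nonneg _), ← ENNReal.ofReal_mul (by positivity), ← mul_pow]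
          refine ENNReal.ofReal_le_ofReal ?_
          gcongr
          exact hzk
      _ ≤ _ := by
          gcongr
          exact Finset.single_le_sum (f := fun i => ‖z i‖ₑ ^ d) (fun i _ => zero_le)
            (Finset.mem_univ k)
  calc ∫⁻ ω, ‖X ω‖ₑ ^ d ∂P ≤ ∫⁻ ω, ENNReal.ofReal (d ^ d) * ∑ i, ‖X ω i‖ₑ ^ d ∂P :=
        lintegral_mono fun ω => hpt (X ω)
    _ = ENNReal.ofReal (d ^ d) * ∑ i, ∫⁻ ω, ‖X ω i‖ₑ ^ d ∂P := by
        rw [lintegral_const_mul _ (by fun_prop), lintegral_finsetSum _ fun i _ => by fun_prop]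
    _ ≤ ENNReal.ofReal (d ^ d) * ∑ i : Fin d, ENNReal.ofReal (d ! * (2 * Real.exp (V / 2))) := by
        gcongr with i
        refine le_trans (le_of_eq ?_) (lintegral_abs_pow_gaussianReal_le d huV)
        rw [← hlaw i, lintegral_map (by fun_prop) (hmi i)]
    _ = _ := by
        rw [Finset.sum_const, Finset.card_univ, Fintype.card_fin, nsmul_eq_mul,
          ← ENNReal.ofReal_natCast, ← ENNReal.ofReal_mul (by positivity),
          ← ENNReal.ofReal_mul (by positivity)]

end Anticoncentration

/-! ### Regression of a Gaussian field on one of its values -/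

section GaussianField

open scoped NNReal

variable {Ω : Type*} [MeasurableSpace Ω] {P : Measure Ω}

/-- The variance of a centred Gaussian process with continuous paths is bounded on compact sets:
`exp (-u x / 2)` is the characteristic function of `g x` at `1`, which is continuous in `x` by
dominated convergence and vanishes nowhere. -/
theorem exists_variance_bound_of_continuous [IsProbabilityMeasure P] {T : Type*}
    [TopologicalSpace T]
    [FirstCountableTopology T] {g : T → Ω → ℝ} (hmeas : ∀ x, Measurable (g x))
    (hcont : ∀ ω, Continuous fun x => g x ω) {u : T → ℝ≥0}
    (hlaw : ∀ x, P.map (g x) = gaussianReal 0 (u x)) {I : Set T} (hI : IsCompact I) :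
    ∃ V : ℝ, ∀ x ∈ I, u x ≤ V := by
  rcases I.eq_empty_or_nonempty with rfl | hne
  · exact ⟨0, by simp⟩
  set φ : T → ℂ := fun x => ∫ ω, Complex.exp (g x ω * Complex.I) ∂P with hφ
  have hφc : Continuous φ := by
    refine continuous_of_dominated (bound := fun _ => 1) (fun x => ?_) (fun x => ?_)
      (integrable_const 1) ?_
    · have := hmeas x
      exact (by fun_prop : Measurable fun ω => Complex.exp (g x ω * Complex.I)).aestronglyMeasurable
    · exact ae_of_all _ fun ω => (Complex.norm_exp_ofReal_mul_I _).le
    · refine ae_of_all _ fun ω => ?_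
      have := hcont ω
      fun_prop
  have hφn : ∀ x, ‖φ x‖ = Real.exp (-(u x / 2)) := by
    intro x
    have h1 := charFun_gaussianReal (μ := 0) (v := u x) 1
    rw [← hlaw x, charFun_apply_real, integral_map (hmeas x).aemeasurable
      (by exact Measurable.aestronglyMeasurable (by fun_prop))] at h1
    simp only [Complex.ofReal_one, one_mul] at h1
    rw [hφ]
    simp only [h1]
    rw [Complex.norm_exp]
    congr 1
    simp only [Complex.ofReal_zero, zero_mul, zero_sub, one_pow, mul_one, Complex.neg_re]
    norm_cast
  obtain ⟨y, -, hy⟩ := hI.exists_isMinOn hne hφc.norm.continuousOn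
  refine ⟨u y, fun x hx => ?_⟩
  have := hy hx
  simp only [mem_ofPred_eq, hφn, Real.exp_le_exp] at this
  linarith

/-- An anticoncentration bound at deterministic scales extends to a random scale independent of
`X`. -/
theorem measure_enorm_sub_le_mul_of_indepFun {d : ℕ} [NeZero d] [IsProbabilityMeasure P]
    {X : Ω → EuclideanSpace ℝ (Fin d)} {T : Ω → ℝ≥0∞} (hX : Measurable X) (hT : Measurable T)
    (hXT : IndepFun X T P) {C : ℝ} (hC : 0 < C) (z : EuclideanSpace ℝ (Fin d))
    (hbound : ∀ a : ℝ, 0 ≤ a →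
      P {ω | ‖X ω - z‖ ≤ a * (1 + ‖X ω‖)} ≤ ENNReal.ofReal (C * a ^ d)) :
    P {ω | ‖X ω - z‖ₑ ≤ T ω * (1 + ‖X ω‖ₑ)} ≤ ENNReal.ofReal C * ∫⁻ ω, T ω ^ d ∂P := by
  set S : Set (EuclideanSpace ℝ (Fin d) × ℝ≥0∞) := {p | ‖p.1 - z‖ₑ ≤ p.2 * (1 + ‖p.1‖ₑ)} with hS
  have hSm : MeasurableSet S := measurableSet_le (by fun_prop) (by fun_prop)
  have hmap := (indepFun_iff_map_prod_eq_prod_map_map hX.aemeasurable hT.aemeasurable).1 hXT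
  have := Measure.isProbabilityMeasure_map (μ := P) hX.aemeasurable
  have := Measure.isProbabilityMeasure_map (μ := P) hT.aemeasurable
  calc P {ω | ‖X ω - z‖ₑ ≤ T ω * (1 + ‖X ω‖ₑ)} = (P.map fun ω => (X ω, T ω)) S := by
        rw [Measure.map_apply (hX.prodMk hT) hSm]; rfl
    _ = ∫⁻ t, (P.map X) ((fun x => (x, t)) ⁻¹' S) ∂(P.map T) := by
        rw [hmap, Measure.prod_apply_symm hSm]
    _ ≤ ∫⁻ t, ENNReal.ofReal C * t ^ d ∂(P.map T) := by
        refine lintegral_mono fun t => ?_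
        rw [Measure.map_apply hX (measurable_prodMk_right hSm)]
        rcases eq_or_ne t ∞ with rfl | ht
        -- At the scale `∞` the bound is infinite because `d ≠ 0`.
        · rw [ENNReal.top_pow (NeZero.ne d), ENNReal.mul_top (by simpa using hC)]
          exact le_top
        · have h1 := hbound t.toReal ENNReal.toReal_nonneg
          rw [ENNReal.ofReal_mul hC.le, ENNReal.ofReal_pow ENNReal.toReal_nonneg,
            ENNReal.ofReal_toReal ht] at h1
          refine le_trans (measure_mono fun ω hω => ?_) h1
          simp only [hS, mem_preimage, mem_ofPred_eq] at hω ⊢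
          rw [← ENNReal.ofReal_toReal ht, ← ofReal_norm, ← ofReal_norm, ← ENNReal.ofReal_one,
            ← ENNReal.ofReal_add zero_le_one (norm_nonneg _),
            ← ENNReal.ofReal_mul ENNReal.toReal_nonneg,
            ENNReal.ofReal_le_ofReal_iff (by positivity)] at hω
          exact hω
    _ = ENNReal.ofReal C * ∫⁻ ω, T ω ^ d ∂P := by
        rw [lintegral_const_mul _ (by fun_prop), lintegral_map (by fun_prop) hT]

variable {m d : ℕ} {E : Type*} {v : E → Ω → EuclideanSpace ℝ (Fin d)}

theorem hasGaussianLaw_component (hgauss : IsGaussianProcess v P) (x : E) (i : Fin d) :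
    HasGaussianLaw (fun ω => v x ω i) P :=
  (hgauss.hasGaussianLaw_eval x).map_fun (EuclideanSpace.proj i)

theorem integral_component_eq_zero (hgauss : IsGaussianProcess v P)
    (hcentered : ∀ x, ∫ ω, v x ω ∂P = 0) (x : E) (i : Fin d) : ∫ ω, v x ω i ∂P = 0 := by
  have h := ContinuousLinearMap.integral_comp_comm (EuclideanSpace.proj (𝕜 := ℝ) i)
    (hgauss.hasGaussianLaw_eval x).integrable
  rw [hcentered, map_zero] at h
  exact h

variable [NeZero d]

theorem map_component_eq_gaussianReal (hgauss : IsGaussianProcess v P)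
    (hcentered : ∀ x, ∫ ω, v x ω ∂P = 0)
    (hident : ∀ i k : Fin d, IdentDistrib (fun ω x => v x ω i) (fun ω x => v x ω k) P P)
    (x : E) (i : Fin d) :
    P.map (fun ω => v x ω i) = gaussianReal 0 (variance (fun ω => v x ω 0) P).toNNReal := by
  have h1 : IdentDistrib (fun ω => v x ω i) (fun ω => v x ω 0) P P :=
    (hident i 0).comp (measurable_pi_apply x)
  rw [h1.map_eq, (hasGaussianLaw_component hgauss x 0).map_eq_gaussianReal,
    integral_component_eq_zero hgauss hcentered]

theorem covariance_component (hmeas : ∀ x, Measurable (v x)) (hgauss : IsGaussianProcess v P)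
    (hindep : iIndepFun (fun (i : Fin d) ω (x : E) => v x ω i) P)
    (hident : ∀ i k : Fin d, IdentDistrib (fun ω x => v x ω i) (fun ω x => v x ω k) P P)
    (x y : E) (i k : Fin d) :
    cov[fun ω => v x ω i, fun ω => v y ω k; P] =
      if i = k then cov[fun ω => v x ω 0, fun ω => v y ω 0; P] else 0 := by
  have := hgauss.isProbabilityMeasure
  have hm : ∀ i : Fin d, Measurable fun ω (x : E) => v x ω i := fun i =>
    measurable_pi_iff.2 fun x => by have := hmeas x; fun_prop
  split_ifs with hik
  · subst hik
    have h : ∀ k : Fin d, cov[fun f : E → ℝ => f x, fun f : E → ℝ => f y;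
        P.map fun ω (x : E) => v x ω k] = cov[fun ω => v x ω k, fun ω => v y ω k; P] := fun k =>
      covariance_map (measurable_pi_apply x).aestronglyMeasurable
        (measurable_pi_apply y).aestronglyMeasurable (hm k).aemeasurable
    rw [← h i, ← h 0, (hident i 0).map_eq]
  · exact ((hindep.indepFun hik).comp (measurable_pi_apply x)
      (measurable_pi_apply y)).covariance_eq_zero (hasGaussianLaw_component hgauss x i).memLp_two
      (hasGaussianLaw_component hgauss y k).memLp_two

/-- The coefficient of the linear regression of `v x` on `v x₀`. It is computed from the
coordinate `0`; for identically distributed coordinates it is the same for all of them. -/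
noncomputable def regressionCoeff (v : E → Ω → EuclideanSpace ℝ (Fin d)) (P : Measure Ω)
    (x₀ x : E) : ℝ :=
  cov[fun ω => v x ω 0, fun ω => v x₀ ω 0; P] / variance (fun ω => v x₀ ω 0) P

/-- The residual process of the regression on `v x₀` is uncorrelated with `v x₀`, hence
independent of it by joint Gaussianity. -/
theorem indepFun_sub_regression (hmeas : ∀ x, Measurable (v x)) (hgauss : IsGaussianProcess v P)
    (hindep : iIndepFun (fun (i : Fin d) ω (x : E) => v x ω i) P)
    (hident : ∀ i k : Fin d, IdentDistrib (fun ω x => v x ω i) (fun ω x => v x ω k) P P)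
    (x₀ : E) (hvar : variance (fun ω => v x₀ ω 0) P ≠ 0) :
    IndepFun (v x₀) (fun ω x => v x ω - regressionCoeff v P x₀ x • v x₀ ω) P := by
  classical
  have hm : ∀ x (i : Fin d), Measurable fun ω => v x ω i := fun x i => by
    have := hmeas x; fun_prop
  set X : E × Fin d → Ω → ℝ := fun p ω => v p.1 ω p.2 - regressionCoeff v P x₀ p.1 * v x₀ ω p.2
  set Y : Fin d → Ω → ℝ := fun i ω => v x₀ ω i
  have hXY : IsGaussianProcess (Sum.elim X Y) P := by
    refine hgauss.of_isGaussianProcess fun s => ?_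
    rcases s with p | i
    · refine ⟨{p.1, x₀}, (EuclideanSpace.proj p.2 ∘L ContinuousLinearMap.proj ⟨p.1, by simp⟩) -
        regressionCoeff v P x₀ p.1 •
          (EuclideanSpace.proj p.2 ∘L ContinuousLinearMap.proj ⟨x₀, by simp⟩), fun ω => ?_⟩
      simp [X]
    · refine ⟨{x₀}, EuclideanSpace.proj i ∘L ContinuousLinearMap.proj ⟨x₀, by simp⟩, fun ω => ?_⟩
      simp [Y]
  have hind : IndepFun (fun ω p => X p ω) (fun ω i => Y i ω) P := by
    refine hXY.indepFun_of_covariance_eq_zero (fun p => ?_) (fun i => (hm x₀ i).aemeasurable) ?_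
    · have h1 := hm p.1 p.2
      have h2 := hm x₀ p.2
      exact (h1.sub (h2.const_mul (regressionCoeff v P x₀ p.1))).aemeasurable
    · have := hgauss.isProbabilityMeasure
      rintro ⟨x, i⟩ k
      have hL := fun x i => (hasGaussianLaw_component hgauss x i).memLp_two
      simp only [X, Y]
      rw [covariance_fun_sub_left (hL x i) ((hL x₀ i).const_mul _) (hL x₀ k),
        covariance_const_mul_left, covariance_component hmeas hgauss hindep hident x x₀,
        covariance_component hmeas hgauss hindep hident x₀ x₀]
      split_ifs
      · rw [covariance_self (hm x₀ 0).aemeasurable, regressionCoeff, div_mul_cancel₀ _ hvar,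
          sub_self]
      · simp
  have h := hind.symm.comp (φ := fun y : Fin d → ℝ => (WithLp.toLp 2 y : EuclideanSpace ℝ (Fin d)))
    (ψ := fun (y : E × Fin d → ℝ) (x : E) =>
      (WithLp.toLp 2 (fun i => y (x, i)) : EuclideanSpace ℝ (Fin d))) (by fun_prop) (by fun_prop)
  exact h

theorem abs_regressionCoeff_sub_one_le (hgauss : IsGaussianProcess v P)
    (hcentered : ∀ x, ∫ ω, v x ω ∂P = 0) {x₀ x : E} {s V ε k : ℝ} (hs : 0 < s)
    (hsv : s ≤ variance (fun ω => v x₀ ω 0) P) (hvV : variance (fun ω => v x₀ ω 0) P ≤ V)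
    (hε : 0 < ε) (hk : ∫⁻ ω, ‖v x ω - v x₀ ω‖ₑ ^ 2 ∂P ≤ ENNReal.ofReal (k * ε ^ 2)) (hk0 : 0 ≤ k) :
    |regressionCoeff v P x₀ x - 1| ≤ (k + V) / (2 * s) * ε := by
  have := hgauss.isProbabilityMeasure
  have hL := fun x => (hasGaussianLaw_component hgauss x 0).memLp_two
  have hmean := fun x => integral_component_eq_zero hgauss hcentered x 0
  set A : Ω → ℝ := fun ω => v x ω 0 - v x₀ ω 0 with hA
  set B : Ω → ℝ := fun ω => v x₀ ω 0 with hB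
  have hAL : MemLp A 2 P := (hL x).sub (hL x₀)
  have hBL : MemLp B 2 P := hL x₀
  have hv0 : 0 < variance B P := hs.trans_le hsv
  have hvarB : ∫ ω, B ω ^ 2 ∂P = variance B P := by
    rw [variance_of_integral_eq_zero hBL.aemeasurable (hmean x₀)]
  have hA2 : ∫ ω, A ω ^ 2 ∂P ≤ k * ε ^ 2 := by
    rw [integral_eq_lintegral_of_nonneg_ae (ae_of_all _ fun ω => sq_nonneg _)
      hAL.integrable_sq.aestronglyMeasurable]
    refine ENNReal.toReal_le_of_le_ofReal (by positivity) (le_trans (lintegral_mono fun ω => ?_) hk)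
    rw [← ofReal_norm, ← ENNReal.ofReal_pow (norm_nonneg _)]
    refine ENNReal.ofReal_le_ofReal ?_
    rw [← sq_abs]
    gcongr
    simpa using PiLp.norm_apply_le (v x ω - v x₀ ω) 0
  have hcov : regressionCoeff v P x₀ x - 1 = (∫ ω, A ω * B ω ∂P) / variance B P := by
    rw [regressionCoeff, div_sub_one hv0.ne', ← covariance_self hBL.aemeasurable,
      ← covariance_fun_sub_left (hL x) (hL x₀) (hL x₀), covariance_eq_sub hAL hBL]
    simp only [hB, hmean, mul_zero, sub_zero]
    rfl
  -- Young's inequality `|A B| ≤ A² / (2 ε) + ε B² / 2`, with the weight that balances `E A² =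
  -- O(ε²)` against `E B² = O(1)`.
  have hAB : |∫ ω, A ω * B ω ∂P| ≤ (k + V) / 2 * ε := by
    calc |∫ ω, A ω * B ω ∂P| ≤ ∫ ω, |A ω * B ω| ∂P := abs_integral_le_integral_abs
      _ ≤ ∫ ω, (A ω ^ 2 * (1 / (2 * ε)) + B ω ^ 2 * (ε / 2)) ∂P := by
          refine integral_mono (hAL.integrable_mul hBL).abs
            ((hAL.integrable_sq.mul_const _).add (hBL.integrable_sq.mul_const _)) fun ω => ?_
          have h1 : A ω ^ 2 * (1 / (2 * ε)) + B ω ^ 2 * (ε / 2) - |A ω| * |B ω| =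
              (|A ω| - ε * |B ω|) ^ 2 / (2 * ε) := by
            rw [← sq_abs (A ω), ← sq_abs (B ω)]
            field_simp
            ring
          have h2 : 0 ≤ (|A ω| - ε * |B ω|) ^ 2 / (2 * ε) := by positivity
          simp only [abs_mul]
          linarith
      _ = (∫ ω, A ω ^ 2 ∂P) * (1 / (2 * ε)) + variance B P * (ε / 2) := by
          rw [integral_add (hAL.integrable_sq.mul_const _) (hBL.integrable_sq.mul_const _),
            integral_mul_const, integral_mul_const, hvarB]
      _ ≤ k * ε ^ 2 * (1 / (2 * ε)) + V * (ε / 2) := by gcongr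
      _ = _ := by field_simp
  rw [hcov, abs_div, abs_of_pos hv0, div_le_iff₀ hv0]
  have hkV : 0 ≤ k + V := by linarith
  calc _ ≤ (k + V) / 2 * ε := hAB
    _ = (k + V) / (2 * s) * ε * s := by field_simp
    _ ≤ _ := by gcongr

end GaussianField

/-! ### Hitting a small ball -/

section SmallBall

theorem ENNReal.add_pow_le_two_pow_mul (a b : ℝ≥0∞) (n : ℕ) :
    (a + b) ^ n ≤ 2 ^ n * (a ^ n + b ^ n) := by
  calc (a + b) ^ n ≤ (2 * max a b) ^ n := by
        gcongr
        rw [two_mul]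
        exact add_le_add (le_max_left _ _) (le_max_right _ _)
    _ = 2 ^ n * max a b ^ n := mul_pow _ _ _
    _ ≤ _ := by
        gcongr
        rcases max_cases a b with ⟨h, _⟩ | ⟨h, _⟩ <;> rw [h]
        · exact le_self_add
        · exact le_add_self

theorem ENNReal.iSup_pow_le {ι : Sort*} {f : ι → ℝ≥0∞} {b : ℝ≥0∞} {n : ℕ} (hn : n ≠ 0)
    (h : ∀ i, f i ^ n ≤ b) : (⨆ i, f i) ^ n ≤ b := by
  have hn0 : (n : ℝ) ≠ 0 := by exact_mod_cast hn
  have h1 : (⨆ i, f i) ≤ b ^ ((n : ℝ)⁻¹) := by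
    refine iSup_le fun i => ?_
    calc f i = (f i ^ n) ^ ((n : ℝ)⁻¹) := by
          rw [← ENNReal.rpow_natCast, ← ENNReal.rpow_mul, mul_inv_cancel₀ hn0, ENNReal.rpow_one]
      _ ≤ _ := ENNReal.rpow_le_rpow (h i) (by positivity)
  calc (⨆ i, f i) ^ n ≤ (b ^ ((n : ℝ)⁻¹)) ^ n := by gcongr
    _ = b := by
      rw [← ENNReal.rpow_natCast, ← ENNReal.rpow_mul, inv_mul_cancel₀ hn0, ENNReal.rpow_one]

variable {m d : ℕ} [NeZero d] {Ω : Type*} [MeasurableSpace Ω] {P : Measure Ω}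
    {v : EuclideanSpace ℝ (Fin m) → Ω → EuclideanSpace ℝ (Fin d)}

/-- The small ball estimate on a set `R` on which the moments of order `2` and `d` of the
oscillation of `v` about `x₀` are dominated by an integrable `B` at scale `ε`. Since `∫⁻` is a
lower integral, it is monotone and the bounds below hold whether or not `B` is measurable. -/
theorem exists_measure_hitEvent_ball_le (hmeas : ∀ x, Measurable (v x))
    (hcont : ∀ ω, Continuous fun x => v x ω) (hgauss : IsGaussianProcess v P)
    (hcentered : ∀ x, ∫ ω, v x ω ∂P = 0)
    (hindep : iIndepFun (fun (i : Fin d) ω (x : EuclideanSpace ℝ (Fin m)) => v x ω i) P)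
    (hident : ∀ i k : Fin d, IdentDistrib
      (fun ω (x : EuclideanSpace ℝ (Fin m)) => v x ω i)
      (fun ω (x : EuclideanSpace ℝ (Fin m)) => v x ω k) P P)
    {s V κ c : ℝ} (hs : 0 < s) (hV : 0 ≤ V) (hκ : 0 ≤ κ) (hc : 0 ≤ c) :
    ∃ C : ℝ, 0 < C ∧ ∀ (R : Set (EuclideanSpace ℝ (Fin m))) (x₀ : EuclideanSpace ℝ (Fin m))
      (ε : ℝ) (B : Ω → ℝ≥0∞), x₀ ∈ R → 0 < ε → s ≤ variance (fun ω => v x₀ ω 0) P →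
      variance (fun ω => v x₀ ω 0) P ≤ V → ∫⁻ ω, B ω ∂P ≤ ENNReal.ofReal c →
      (∀ ω, ∀ x ∈ R, ‖v x ω - v x₀ ω‖ₑ ^ 2 ≤ ENNReal.ofReal (κ * ε ^ 2) * B ω) →
      (∀ ω, ∀ x ∈ R, ‖v x ω - v x₀ ω‖ₑ ^ d ≤ ENNReal.ofReal (κ * ε ^ d) * B ω) →
      ∀ z, P (hitEvent v R (Metric.ball z ε)) ≤ ENNReal.ofReal (C * ε ^ d) := by
  have hd : (0 : ℝ) < d := by exact_mod_cast Nat.pos_of_ne_zero (NeZero.ne d)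
  have := hgauss.isProbabilityMeasure
  set K : ℝ := (κ * c + V) / (2 * s) with hKdef
  have hK : 0 ≤ K := by positivity
  set C₁ : ℝ := (4 * d) ^ d + (8 * d * gaussianDecayConst d s V) ^ d with hC₁def
  have hC₁ : 0 < C₁ := by rw [hC₁def, gaussianDecayConst]; positivity
  set M : ℝ := d ^ d * (d * (d.factorial * (2 * Real.exp (V / 2)))) with hMdef
  have hM : 0 ≤ M := by positivity
  refine ⟨C₁ * (2 ^ d * ((1 + K) ^ d + 2 ^ d * (κ * c + K ^ d * M))), by positivity, ?_⟩
  intro R x₀ ε B hx₀ hε hsv hvV hB h2 hd' z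
  set u : NNReal := (variance (fun ω => v x₀ ω 0) P).toNNReal with hu
  have hu' : (u : ℝ) = variance (fun ω => v x₀ ω 0) P := Real.coe_toNNReal _ (hs.le.trans hsv)
  have hlaw := fun i => map_component_eq_gaussianReal hgauss hcentered hident x₀ i
  have hX := hmeas x₀
  have hindep₀ : iIndepFun (fun i ω => v x₀ ω i) P :=
    hindep.comp (fun _ f => f x₀) fun _ => measurable_pi_apply x₀
  have hreg : ∀ x ∈ R, |regressionCoeff v P x₀ x - 1| ≤ K * ε := fun x hx => by
    refine abs_regressionCoeff_sub_one_le hgauss hcentered hs hsv hvV hε ?_ (by positivity)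
    calc ∫⁻ ω, ‖v x ω - v x₀ ω‖ₑ ^ 2 ∂P ≤ ∫⁻ ω, ENNReal.ofReal (κ * ε ^ 2) * B ω ∂P :=
          lintegral_mono fun ω => h2 ω x hx
      _ = ENNReal.ofReal (κ * ε ^ 2) * ∫⁻ ω, B ω ∂P :=
          lintegral_const_mul' _ _ ENNReal.ofReal_ne_top
      _ ≤ ENNReal.ofReal (κ * ε ^ 2) * ENNReal.ofReal c := by gcongr
      _ = _ := by rw [← ENNReal.ofReal_mul (by positivity)]; congr 1; ring
  have : Nonempty R := ⟨⟨x₀, hx₀⟩⟩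
  -- Hitting an open ball can be tested on a countable dense subset of `R`, which makes the
  -- supremum `T` of the residuals measurable.
  set D : ℕ → EuclideanSpace ℝ (Fin m) := fun n => TopologicalSpace.denseSeq R n with hD
  have hDR : ∀ n, D n ∈ R := fun n => (TopologicalSpace.denseSeq R n).2
  set w : EuclideanSpace ℝ (Fin m) → Ω → EuclideanSpace ℝ (Fin d) := fun x ω =>
    v x ω - regressionCoeff v P x₀ x • v x₀ ω with hw
  set T : Ω → ℝ≥0∞ := fun ω => ⨆ n, (ENNReal.ofReal ((1 + K) * ε) + ‖w (D n) ω‖ₑ) with hT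
  have hTm : Measurable T := Measurable.iSup fun n => by
    have h1 := hmeas (D n)
    simp only [hw]
    fun_prop
  have hXT : IndepFun (v x₀) T P :=
    (indepFun_sub_regression hmeas hgauss hindep hident x₀ (hs.trans_le hsv).ne').comp
      measurable_id (ψ := fun f : EuclideanSpace ℝ (Fin m) → EuclideanSpace ℝ (Fin d) =>
        ⨆ n, (ENNReal.ofReal ((1 + K) * ε) + ‖f (D n)‖ₑ)) (by fun_prop)
  have hsub : hitEvent v R (Metric.ball z ε) ⊆
      {ω | ‖v x₀ ω - z‖ₑ ≤ T ω * (1 + ‖v x₀ ω‖ₑ)} := by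
    rintro ω ⟨_, ⟨x, hx, rfl⟩, hxz⟩
    have hopen : IsOpen {y : R | v y ω ∈ Metric.ball z ε} :=
      Metric.isOpen_ball.preimage ((hcont ω).comp continuous_subtype_val)
    obtain ⟨n, hn⟩ := (TopologicalSpace.denseRange_denseSeq R).exists_mem_open hopen ⟨⟨x, hx⟩, hxz⟩
    have hn' : ‖v (D n) ω - z‖ < ε := mem_ball_iff_norm.1 hn
    have h1 : v x₀ ω - z = (v (D n) ω - z) - w (D n) ω -
        (regressionCoeff v P x₀ (D n) - 1) • v x₀ ω := by
      simp only [hw]; module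
    have h3 : ‖v x₀ ω - z‖ ≤ ((1 + K) * ε + ‖w (D n) ω‖) * (1 + ‖v x₀ ω‖) := by
      have h4 : ‖v x₀ ω - z‖ ≤ ‖v (D n) ω - z‖ + ‖w (D n) ω‖ +
          |regressionCoeff v P x₀ (D n) - 1| * ‖v x₀ ω‖ := by
        rw [h1, ← Real.norm_eq_abs, ← norm_smul]
        exact (norm_sub_le _ _).trans (add_le_add_left (norm_sub_le _ _) _)
      have h5 : |regressionCoeff v P x₀ (D n) - 1| * ‖v x₀ ω‖ ≤ K * ε * ‖v x₀ ω‖ := by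
        gcongr; exact hreg _ (hDR n)
      have h6 : 0 ≤ K * ε + ε * ‖v x₀ ω‖ + ‖w (D n) ω‖ * ‖v x₀ ω‖ := by positivity
      nlinarith
    simp only [mem_ofPred_eq]
    calc ‖v x₀ ω - z‖ₑ ≤ (ENNReal.ofReal ((1 + K) * ε) + ‖w (D n) ω‖ₑ) * (1 + ‖v x₀ ω‖ₑ) := by
          rw [← ofReal_norm, ← ofReal_norm, ← ofReal_norm, ← ENNReal.ofReal_one,
            ← ENNReal.ofReal_add zero_le_one (norm_nonneg _),
            ← ENNReal.ofReal_add (by positivity) (norm_nonneg _),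
            ← ENNReal.ofReal_mul (by positivity)]
          exact ENNReal.ofReal_le_ofReal h3
      _ ≤ _ := by
          gcongr
          exact le_iSup (fun n => ENNReal.ofReal ((1 + K) * ε) + ‖w (D n) ω‖ₑ) n
  have hTd : ∀ ω, T ω ^ d ≤ 2 ^ d * (ENNReal.ofReal ((1 + K) * ε) ^ d +
      2 ^ d * (ENNReal.ofReal (κ * ε ^ d) * B ω + ENNReal.ofReal (K * ε) ^ d * ‖v x₀ ω‖ₑ ^ d)) := by
    intro ω
    refine ENNReal.iSup_pow_le (NeZero.ne d) fun n => ?_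
    refine (ENNReal.add_pow_le_two_pow_mul _ _ d).trans ?_
    gcongr
    have h3 : ‖w (D n) ω‖ₑ ≤ ‖v (D n) ω - v x₀ ω‖ₑ + ENNReal.ofReal (K * ε) * ‖v x₀ ω‖ₑ := by
      have h4 : w (D n) ω = (v (D n) ω - v x₀ ω) -
          (regressionCoeff v P x₀ (D n) - 1) • v x₀ ω := by
        simp only [hw]; module
      rw [h4]
      refine enorm_sub_le.trans ?_
      rw [enorm_smul, Real.enorm_eq_ofReal_abs]
      gcongr
      exact hreg _ (hDR n)
    calc ‖w (D n) ω‖ₑ ^ d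
        ≤ (‖v (D n) ω - v x₀ ω‖ₑ + ENNReal.ofReal (K * ε) * ‖v x₀ ω‖ₑ) ^ d := by gcongr
      _ ≤ 2 ^ d * (‖v (D n) ω - v x₀ ω‖ₑ ^ d + (ENNReal.ofReal (K * ε) * ‖v x₀ ω‖ₑ) ^ d) :=
          ENNReal.add_pow_le_two_pow_mul _ _ d
      _ ≤ _ := by
          rw [mul_pow]
          gcongr
          exact hd' ω _ (hDR n)
  have hmom := lintegral_enorm_pow_le_of_gaussian (V := V) (by rw [hu']; exact hvV) hX hlaw
  have hTint : ∫⁻ ω, T ω ^ d ∂P ≤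
      ENNReal.ofReal (2 ^ d * ((1 + K) ^ d + 2 ^ d * (κ * c + K ^ d * M)) * ε ^ d) := by
    calc ∫⁻ ω, T ω ^ d ∂P ≤ ∫⁻ ω, 2 ^ d * (ENNReal.ofReal ((1 + K) * ε) ^ d +
          2 ^ d * (ENNReal.ofReal (κ * ε ^ d) * B ω +
            ENNReal.ofReal (K * ε) ^ d * ‖v x₀ ω‖ₑ ^ d)) ∂P := lintegral_mono hTd
      _ = 2 ^ d * (ENNReal.ofReal ((1 + K) * ε) ^ d +
          2 ^ d * (ENNReal.ofReal (κ * ε ^ d) * ∫⁻ ω, B ω ∂P +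
            ENNReal.ofReal (K * ε) ^ d * ∫⁻ ω, ‖v x₀ ω‖ₑ ^ d ∂P)) := by
          have h2t : (2 : ℝ≥0∞) ^ d ≠ ∞ := by simp
          rw [lintegral_const_mul' _ _ h2t, lintegral_add_left measurable_const,
            lintegral_const_mul' _ _ h2t, lintegral_add_right _ (by fun_prop),
            lintegral_const_mul' _ _ ENNReal.ofReal_ne_top,
            lintegral_const_mul' _ _ (by simp), lintegral_const, measure_univ, mul_one]
      _ ≤ 2 ^ d * (ENNReal.ofReal ((1 + K) * ε) ^ d +
          2 ^ d * (ENNReal.ofReal (κ * ε ^ d) * ENNReal.ofReal c +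
            ENNReal.ofReal (K * ε) ^ d * ENNReal.ofReal M)) := by gcongr
      _ = _ := by
          have h2' : (2 : ℝ≥0∞) ^ d = ENNReal.ofReal (2 ^ d) := by
            rw [ENNReal.ofReal_pow zero_le_two]; simp
          rw [h2', ← ENNReal.ofReal_pow (by positivity), ← ENNReal.ofReal_pow (by positivity),
            ← ENNReal.ofReal_mul (by positivity), ← ENNReal.ofReal_mul (by positivity),
            ← ENNReal.ofReal_add (by positivity) (by positivity),
            ← ENNReal.ofReal_mul (by positivity),
            ← ENNReal.ofReal_add (by positivity) (by positivity),
            ← ENNReal.ofReal_mul (by positivity)]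
          congr 1
          rw [mul_pow, mul_pow]
          ring
  calc P (hitEvent v R (Metric.ball z ε))
      ≤ P {ω | ‖v x₀ ω - z‖ₑ ≤ T ω * (1 + ‖v x₀ ω‖ₑ)} := measure_mono hsub
    _ ≤ ENNReal.ofReal C₁ * ∫⁻ ω, T ω ^ d ∂P :=
        measure_enorm_sub_le_mul_of_indepFun hX hTm hXT hC₁ z fun a ha =>
          measure_norm_sub_le_mul_one_add_norm_le hs (by rw [hu']; exact hsv)
            (by rw [hu']; exact hvV) hX hlaw hindep₀ z ha
    _ ≤ ENNReal.ofReal C₁ *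
        ENNReal.ofReal (2 ^ d * ((1 + K) ^ d + 2 ^ d * (κ * c + K ^ d * M)) * ε ^ d) := by gcongr
    _ = _ := by rw [← ENNReal.ofReal_mul hC₁.le]; congr 1; ring

end SmallBall

/-! ### Boxes, coverings and Hausdorff measure -/

section Boxes

variable {m : ℕ} {δ ε : ℝ} (j : Fin m → ℤ)

theorem dyadicBox_eq_preimage : dyadicBox δ ε j = WithLp.ofLp ⁻¹'
    (Icc (fun l => (j l : ℝ) * ε ^ (1 / δ)) fun l => ((j l : ℝ) + 1) * ε ^ (1 / δ)) := by
  ext x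
  simp only [dyadicBox, mem_ofPred_eq, mem_preimage, mem_Icc, Pi.le_def]
  exact forall_and

theorem isCompact_dyadicBox : IsCompact (dyadicBox δ ε j) := by
  rw [dyadicBox_eq_preimage]
  exact (EuclideanSpace.equiv (Fin m) ℝ).toHomeomorph.isCompact_preimage.2 isCompact_Icc

theorem convex_dyadicBox : Convex ℝ (dyadicBox δ ε j) := by
  rw [dyadicBox_eq_preimage]
  exact (convex_Icc _ _).linear_preimage (EuclideanSpace.equiv (Fin m) ℝ).toLinearMap

theorem volume_dyadicBox :
    volume (dyadicBox δ ε j) = ENNReal.ofReal (ε ^ (1 / δ)) ^ m := by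
  rw [dyadicBox_eq_preimage, (PiLp.volume_preserving_ofLp (Fin m)).measure_preimage
    measurableSet_Icc.nullMeasurableSet, Real.volume_Icc_pi]
  have : ∀ l, ((j l : ℝ) + 1) * ε ^ (1 / δ) - (j l : ℝ) * ε ^ (1 / δ) = ε ^ (1 / δ) :=
    fun l => by ring
  simp only [this]
  simp

theorem norm_sub_le_of_mem_dyadicBox [NeZero m] {x y : EuclideanSpace ℝ (Fin m)}
    (hx : x ∈ dyadicBox δ ε j) (hy : y ∈ dyadicBox δ ε j) : ‖x - y‖ ≤ m * ε ^ (1 / δ) := by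
  obtain ⟨k, -, hk⟩ := Finset.exists_max_image (Finset.univ : Finset (Fin m))
    (fun i => |(x - y) i|) ⟨0, Finset.mem_univ 0⟩
  refine (norm_le_card_mul_of_abs_le (x - y) fun i => hk i (Finset.mem_univ i)).trans ?_
  gcongr
  have h1 := hx k
  have h2 := hy k
  simp only [PiLp.sub_apply]
  rw [abs_le]
  constructor <;> linarith [h1.1, h1.2, h2.1, h2.2]

/-- A ball of radius `M` is covered by `O(ε ^ (-m / δ))` boxes of side `ε ^ (1 / δ)`. -/
theorem exists_finset_dyadicBox_cover (hε : ε ∈ Ioo (0 : ℝ) 1) (hδ : 0 < δ) {M : ℝ} (hM : 0 ≤ M) :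
    ∃ J : Finset (Fin m → ℤ), (J.card : ℝ) ≤ (2 * M + 3) ^ m * ε ^ (-((m : ℝ) / δ)) ∧
      ∀ x : EuclideanSpace ℝ (Fin m), ‖x‖ ≤ M → ∃ j ∈ J, x ∈ dyadicBox δ ε j := by
  obtain ⟨hε0, hε1⟩ := hε
  set s : ℝ := ε ^ (1 / δ) with hs
  have hs0 : 0 < s := Real.rpow_pos_of_pos hε0 _
  have hs1 : s ≤ 1 := Real.rpow_le_one hε0.le hε1.le (by positivity)
  set n : ℤ := ⌈M / s⌉ with hn
  have hn0 : 0 ≤ n := Int.ceil_nonneg (by positivity)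
  refine ⟨Fintype.piFinset fun _ => Finset.Icc (-n) n, ?_, fun x hx => ?_⟩
  · have hcard : ((Finset.Icc (-n) n).card : ℝ) = 2 * n + 1 := by
      have : ((Finset.Icc (-n) n).card : ℤ) = 2 * n + 1 := by rw [Int.card_Icc]; omega
      exact_mod_cast this
    have hle : (2 * n + 1 : ℝ) ≤ (2 * M + 3) * s⁻¹ := by
      have h1 : (n : ℝ) < M / s + 1 := Int.ceil_lt_add_one _
      have h2 : 1 ≤ s⁻¹ := (one_le_inv₀ hs0).2 hs1
      rw [div_eq_mul_inv] at h1
      linarith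
    rw [Fintype.card_piFinset_const]
    push_cast
    rw [hcard]
    calc (2 * n + 1 : ℝ) ^ m ≤ ((2 * M + 3) * s⁻¹) ^ m := by
          have : (0 : ℝ) ≤ n := by exact_mod_cast hn0
          gcongr
      _ = _ := by
        rw [mul_pow, hs, ← Real.rpow_neg hε0.le, ← Real.rpow_mul_natCast hε0.le]
        congr 2
        ring
  · refine ⟨fun l => ⌊x l / s⌋, ?_, fun l => ⟨?_, ?_⟩⟩
    · rw [Fintype.mem_piFinset]
      intro l
      have h1 : |x l| ≤ M := (PiLp.norm_apply_le x l).trans hx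
      have h2 : M / s ≤ n := Int.le_ceil _
      rw [abs_le] at h1
      have h3 : x l / s ≤ M / s := by gcongr; exact h1.2
      have h4 : -(M / s) ≤ x l / s := by rw [← neg_div]; gcongr; exact h1.1
      rw [Finset.mem_Icc]
      constructor
      · rw [Int.le_floor]; push_cast; linarith
      · have := Int.floor_le (x l / s)
        exact Int.cast_le.1 (this.trans (h3.trans h2))
    · rw [← le_div_iff₀ hs0]; exact Int.floor_le _
    · rw [← div_le_iff₀ hs0]; exact (Int.lt_floor_add_one _).le

end Boxes

section Hitting

variable {m d : ℕ} {Ω : Type*} [MeasurableSpace Ω] {P : Measure Ω}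
    {v : EuclideanSpace ℝ (Fin m) → Ω → EuclideanSpace ℝ (Fin d)}

/-- A union bound over the boxes that meet `I`. -/
theorem measure_hitEvent_ball_le_rpow {I : Set (EuclideanSpace ℝ (Fin m))} {M δ C : ℝ} (hδ : 0 < δ)
    (hM : 0 ≤ M) (hIM : ∀ x ∈ I, ‖x‖ ≤ M) (hC : 0 ≤ C) {ε : ℝ} (hε : ε ∈ Ioo (0 : ℝ) 1)
    {z : EuclideanSpace ℝ (Fin d)}
    (hbox : ∀ j : Fin m → ℤ, (dyadicBox δ ε j ∩ I).Nonempty →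
      P (hitEvent v (dyadicBox δ ε j) (Metric.ball z ε)) ≤ ENNReal.ofReal (C * ε ^ d)) :
    P (hitEvent v I (Metric.ball z ε)) ≤
      ENNReal.ofReal ((2 * M + 3) ^ m * C * ε ^ ((d : ℝ) - m / δ)) := by
  classical
  obtain ⟨J, hJ, hcov⟩ := exists_finset_dyadicBox_cover (m := m) hε hδ hM
  set J' := J.filter fun j => (dyadicBox δ ε j ∩ I).Nonempty with hJ'
  have hsub : hitEvent v I (Metric.ball z ε) ⊆
      ⋃ j ∈ J', hitEvent v (dyadicBox δ ε j) (Metric.ball z ε) := by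
    rintro ω ⟨_, ⟨x, hx, rfl⟩, hxz⟩
    obtain ⟨j, hj, hxj⟩ := hcov x (hIM x hx)
    simp only [mem_iUnion]
    exact ⟨j, Finset.mem_filter.2 ⟨hj, ⟨x, hxj, hx⟩⟩, _, ⟨x, hxj, rfl⟩, hxz⟩
  have hε0 := hε.1
  calc P (hitEvent v I (Metric.ball z ε))
      ≤ ∑ j ∈ J', P (hitEvent v (dyadicBox δ ε j) (Metric.ball z ε)) :=
        (measure_mono hsub).trans (measure_biUnion_finset_le _ _)
    _ ≤ ∑ _j ∈ J', ENNReal.ofReal (C * ε ^ d) :=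
        Finset.sum_le_sum fun j hj => hbox j (Finset.mem_filter.1 hj).2
    _ = ENNReal.ofReal (J'.card * (C * ε ^ d)) := by
        rw [Finset.sum_const, nsmul_eq_mul, ENNReal.ofReal_mul (Nat.cast_nonneg _),
          ENNReal.ofReal_natCast]
    _ ≤ _ := by
        refine ENNReal.ofReal_le_ofReal ?_
        have h1 : (J'.card : ℝ) ≤ (2 * M + 3) ^ m * ε ^ (-((m : ℝ) / δ)) :=
          le_trans (by exact_mod_cast Finset.card_filter_le _ _) hJ
        calc (J'.card : ℝ) * (C * ε ^ d)
            ≤ (2 * M + 3) ^ m * ε ^ (-((m : ℝ) / δ)) * (C * ε ^ d) := by gcongr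
          _ = _ := by
            rw [sub_eq_neg_add, Real.rpow_add hε0, Real.rpow_natCast]; ring

theorem measure_hitEvent_le_ballHausdorff {S : Set (EuclideanSpace ℝ (Fin m))} {γ C : ℝ}
    (hC : 0 < C) (hball : ∀ ε ∈ Ioo (0 : ℝ) 1, ∀ z : EuclideanSpace ℝ (Fin d),
      P (hitEvent v S (Metric.ball z ε)) ≤ ENNReal.ofReal (C * ε ^ γ))
    (A : Set (EuclideanSpace ℝ (Fin d))) :
    P (hitEvent v S A) ≤ ENNReal.ofReal C * ballHausdorff γ A := by
  have hC0 : ENNReal.ofReal C ≠ 0 := by simpa using hC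
  rw [ballHausdorff]
  split_ifs with hγ
  · rw [ENNReal.mul_top hC0]; exact le_top
  push Not at hγ
  rw [mul_comm, ← ENNReal.div_le_iff_le_mul (.inl hC0) (.inl ENNReal.ofReal_ne_top)]
  refine le_liminf_of_le (by isBoundedDefault) ?_
  filter_upwards [Ioo_mem_nhdsGT (zero_lt_one' ℝ)] with e he
  refine le_sInf ?_
  rintro _ ⟨x, r, hr, hA, rfl⟩
  rw [ENNReal.div_le_iff_le_mul (.inl hC0) (.inl ENNReal.ofReal_ne_top), mul_comm]
  have hsub : hitEvent v S A ⊆ ⋃ i, hitEvent v S (Metric.ball (x i) (r i)) := by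
    rintro ω ⟨y, hyS, hyA⟩
    obtain ⟨i, hi⟩ := mem_iUnion.1 (hA hyA)
    exact mem_iUnion.2 ⟨i, y, hyS, hi⟩
  refine (measure_mono hsub).trans ((measure_iUnion_le _).trans ?_)
  rw [← ENNReal.tsum_mul_left]
  refine ENNReal.tsum_le_tsum fun i => ?_
  split_ifs with hi
  · refine (hball (r i) ⟨hi, (hr i).2.trans_lt he.2⟩ (x i)).trans ?_
    rw [← ENNReal.ofReal_mul hC.le]
    refine ENNReal.ofReal_le_ofReal ?_
    gcongr
    linarith
  · rw [Metric.ball_eq_empty.2 (not_lt.1 hi)]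
    simp [hitEvent]

/-- On a box of side `ε ^ (1 / δ)` the oscillation is of order `ε`, with a constant that depends
on neither the box, `ε` nor the function. -/
theorem exists_enorm_sub_pow_le_on_dyadicBox [NeZero m] {δ : ℝ} (hδ : 0 < δ) (F : Type*)
    [NormedAddCommGroup F] {p : ℕ} (hp : p ≠ 0) :
    ∃ κ : ℝ, 0 ≤ κ ∧ ∀ (f : EuclideanSpace ℝ (Fin m) → F), Continuous f → ∀ ε : ℝ, 0 < ε →
      ∀ j : Fin m → ℤ, ∀ x ∈ dyadicBox δ ε j, ∀ x' ∈ dyadicBox δ ε j,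
      ‖f x - f x'‖ₑ ^ p ≤ ENNReal.ofReal (κ * ε ^ p) *
        ((∫⁻ y in dyadicBox δ ε j, ∫⁻ y' in dyadicBox δ ε j,
          ENNReal.ofReal (Real.exp (‖f y - f y'‖ / ‖y - y'‖ ^ δ))) /
            ENNReal.ofReal (ε ^ (2 * (m : ℝ) / δ))) := by
  have hK : 0 ≤ chainingConst m δ := chainingConst_nonneg m δ
  refine ⟨(p * (2 * (2 * m) ^ δ * (chainingConst m δ + 1))) ^ p, by positivity, ?_⟩
  intro f hf ε hε j x hx x' hx'
  have hm : (0 : ℝ) < m := by exact_mod_cast Nat.pos_of_ne_zero (NeZero.ne m)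
  have hs : 0 < ε ^ (1 / δ) := Real.rpow_pos_of_pos hε _
  have hvol := volume_dyadicBox (δ := δ) (ε := ε) j
  have h := enorm_sub_pow_le_lintegral_exp hδ hf (isCompact_dyadicBox j) (convex_dyadicBox j)
    (by rw [hvol]; exact pow_ne_zero _ (by simpa using hs)) (by positivity : 0 < m * ε ^ (1 / δ))
    (fun y hy y' hy' => norm_sub_le_of_mem_dyadicBox j hy hy') hp hx hx'
  have h1 : (2 * (m * ε ^ (1 / δ))) ^ δ = (2 * m) ^ δ * ε := by
    rw [← mul_assoc, Real.mul_rpow (by positivity) hs.le, ← Real.rpow_mul hε.le,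
      one_div_mul_cancel hδ.ne', Real.rpow_one]
  have h2 : volume (dyadicBox δ ε j) ^ 2 = ENNReal.ofReal (ε ^ (2 * (m : ℝ) / δ)) := by
    rw [hvol, ← pow_mul, ← ENNReal.ofReal_pow hs.le, ← Real.rpow_mul_natCast hε.le]
    congr 2
    push_cast
    ring
  have h3 : (p * (2 * (2 * m) ^ δ * (chainingConst m δ + 1))) ^ p * ε ^ p =
      (p * (2 * (2 * (m * ε ^ (1 / δ))) ^ δ * (chainingConst m δ + 1))) ^ p := by
    rw [h1, ← mul_pow]
    congr 1
    ring
  rwa [h3, ← h2]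

end Hitting

theorem mainTheorem5 {m d : ℕ} [NeZero m] [NeZero d]
    {Ω : Type*} [MeasurableSpace Ω] (P : Measure Ω) [IsProbabilityMeasure P]
    (I : Set (EuclideanSpace ℝ (Fin m))) (hI : IsCompact I) (hIpos : 0 < volume I)
    (v : EuclideanSpace ℝ (Fin m) → Ω → EuclideanSpace ℝ (Fin d))
    (hmeas : ∀ x, Measurable (v x))
    (hcont : ∀ ω, Continuous fun x => v x ω)
    (hgauss : IsGaussianProcess v P)
    (hcentered : ∀ x, ∫ ω, v x ω ∂P = 0)
    (hindep : iIndepFun (fun (i : Fin d) ω (x : EuclideanSpace ℝ (Fin m)) => v x ω i) P)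
    (hident : ∀ i k : Fin d, IdentDistrib
      (fun ω (x : EuclideanSpace ℝ (Fin m)) => v x ω i)
      (fun ω (x : EuclideanSpace ℝ (Fin m)) => v x ω k) P P)
    (hvar : 0 < ⨅ x : Metric.thickening 1 I, variance (fun ω => v x ω 0) P)
    (δ : ℝ) (hδ : δ ∈ Ioc (0 : ℝ) 1)
    (hexp : ∃ c : ℝ, ∀ᶠ ε : ℝ in 𝓝[>] 0, ∀ j : Fin m → ℤ, (dyadicBox δ ε j ∩ I).Nonempty →
      ∫⁻ ω, (∫⁻ y in dyadicBox δ ε j, ∫⁻ y' in dyadicBox δ ε j,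
          ENNReal.ofReal (Real.exp (‖v y ω - v y' ω‖ / ‖y - y'‖ ^ δ))) ∂P
        ≤ ENNReal.ofReal (c * ε ^ (2 * (m : ℝ) / δ))) :
    ∃ C : ℝ, 0 < C ∧
      (∀ ε ∈ Ioo (0 : ℝ) 1, ∀ j : Fin m → ℤ, (dyadicBox δ ε j ∩ I).Nonempty →
        ∀ z : EuclideanSpace ℝ (Fin d),
          P (hitEvent v (dyadicBox δ ε j) (Metric.ball z ε)) ≤ ENNReal.ofReal (C * ε ^ d)) ∧
      ∀ A : Set (EuclideanSpace ℝ (Fin d)), MeasurableSet A →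
        P (hitEvent v I A) ≤ ENNReal.ofReal C * ballHausdorff ((d : ℝ) - (m : ℝ) / δ) A := by
  obtain ⟨c, hc⟩ := hexp
  obtain ⟨ε₀, hε₀, hε₀c⟩ := mem_nhdsGT_iff_exists_Ioo_subset.1 hc
  obtain ⟨V, hV⟩ := exists_variance_bound_of_continuous (P := P) (g := fun x ω => v x ω 0)
    (fun x => by have := hmeas x; fun_prop) (fun ω => by have := hcont ω; fun_prop)
    (fun x => map_component_eq_gaussianReal hgauss hcentered hident x 0) hI
  obtain ⟨κ₁, hκ₁, h₁⟩ := exists_enorm_sub_pow_le_on_dyadicBox (m := m) hδ.1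
    (EuclideanSpace ℝ (Fin d)) two_ne_zero
  obtain ⟨κ₂, hκ₂, h₂⟩ := exists_enorm_sub_pow_le_on_dyadicBox (m := m) hδ.1
    (EuclideanSpace ℝ (Fin d)) (NeZero.ne d)
  obtain ⟨C₁, hC₁, hball⟩ := exists_measure_hitEvent_ball_le (κ := κ₁ + κ₂) (V := max V 0)
    (c := max c 0) hmeas hcont hgauss hcentered hindep hident hvar (le_max_right _ _)
    (by positivity) (le_max_right _ _)
  have hε₀' : (0 : ℝ) < ε₀ := hε₀
  set C : ℝ := C₁ + (ε₀⁻¹) ^ d with hC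
  have hC0 : 0 < C := by positivity
  have hbox : ∀ ε ∈ Ioo (0 : ℝ) 1, ∀ j : Fin m → ℤ, (dyadicBox δ ε j ∩ I).Nonempty →
      ∀ z : EuclideanSpace ℝ (Fin d),
        P (hitEvent v (dyadicBox δ ε j) (Metric.ball z ε)) ≤ ENNReal.ofReal (C * ε ^ d) := by
    rintro ε ⟨hε0, hε1⟩ j hj z
    -- The moment hypothesis is available for `ε < ε₀` only; for `ε ≥ ε₀` the right-hand side is at
    -- least `1`.
    rcases lt_or_ge ε ε₀ with hlt | hge
    · obtain ⟨x₀, hx₀, hx₀I⟩ := hj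
      have hb : 0 < ε ^ (2 * (m : ℝ) / δ) := Real.rpow_pos_of_pos hε0 _
      have hmono : ∀ κ ≤ κ₁ + κ₂, ∀ p : ℕ, ENNReal.ofReal (κ * ε ^ p) ≤
          ENNReal.ofReal ((κ₁ + κ₂) * ε ^ p) := fun κ hκ p =>
        ENNReal.ofReal_le_ofReal (by gcongr)
      refine (hball (dyadicBox δ ε j) x₀ ε (fun ω => (∫⁻ y in dyadicBox δ ε j,
        ∫⁻ y' in dyadicBox δ ε j,
          ENNReal.ofReal (Real.exp (‖v y ω - v y' ω‖ / ‖y - y'‖ ^ δ))) /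
            ENNReal.ofReal (ε ^ (2 * (m : ℝ) / δ))) hx₀ hε0 ?_ ?_ ?_ ?_ ?_ z).trans ?_
      · exact ciInf_le ⟨0, by rintro _ ⟨x, rfl⟩; exact variance_nonneg _ _⟩
          (⟨x₀, Metric.self_subset_thickening one_pos I hx₀I⟩ : Metric.thickening 1 I)
      · exact (Real.le_coe_toNNReal _).trans ((hV x₀ hx₀I).trans (le_max_left _ _))
      · simp only [ENNReal.div_eq_inv_mul]
        rw [lintegral_const_mul' _ _ (ENNReal.inv_ne_top.2 (ENNReal.ofReal_pos.2 hb).ne'),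
          ← ENNReal.div_eq_inv_mul]
        refine ENNReal.div_le_of_le_mul ?_
        rw [← ENNReal.ofReal_mul (le_max_right _ _)]
        refine (hε₀c ⟨hε0, hlt⟩ j ⟨x₀, hx₀, hx₀I⟩).trans (ENNReal.ofReal_le_ofReal ?_)
        gcongr
        exact le_max_left _ _
      · exact fun ω x hx => (h₁ _ (hcont ω) ε hε0 j x hx x₀ hx₀).trans
          (mul_le_mul_left (hmono κ₁ (by linarith) 2) _)
      · exact fun ω x hx => (h₂ _ (hcont ω) ε hε0 j x hx x₀ hx₀).trans
          (mul_le_mul_left (hmono κ₂ (by linarith) d) _)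
      · refine ENNReal.ofReal_le_ofReal ?_
        gcongr
        rw [hC]
        have : 0 ≤ (ε₀⁻¹) ^ d := by positivity
        linarith
    · refine prob_le_one.trans ?_
      rw [← ENNReal.ofReal_one]
      refine ENNReal.ofReal_le_ofReal ?_
      have h3 : 1 ≤ (ε₀⁻¹ * ε) ^ d := one_le_pow₀ (by
        rw [inv_mul_eq_div, le_div_iff₀ hε₀']; linarith)
      rw [mul_pow] at h3
      have h4 : 0 ≤ C₁ * ε ^ d := by positivity
      rw [hC, add_mul]
      linarith
  obtain ⟨M, hM0, hM⟩ := hI.isBounded.exists_pos_norm_le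
  have hN : 1 ≤ (2 * M + 3) ^ m := one_le_pow₀ (by linarith)
  refine ⟨(2 * M + 3) ^ m * C, by positivity, fun ε hε j hj z => ?_, fun A _ => ?_⟩
  · refine (hbox ε hε j hj z).trans (ENNReal.ofReal_le_ofReal ?_)
    have hε0 := hε.1
    gcongr
    exact le_mul_of_one_le_left hC0.le hN
  · exact measure_hitEvent_le_ballHausdorff (by positivity) (fun ε hε z =>
      measure_hitEvent_ball_le_rpow hδ.1 hM0.le hM hC0.le hε fun j hj => hbox ε hε j hj z) A
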